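/- **Setting.** Let $f\ge 2$ be an integer and let $G=(V,E)$ be a finite multi-hypergraph (parallel edges allowed) in which every edge has at most $f$ endpoints; $\delta(v)$ is the set of edges having $v$ as an endpoint. Each vertex $v$ has a capacity $k_v\in\mathbb Z_{\ge0}$ and a multiplicity $m_v\in\mathbb Z_{\ge0}$. A *feasible solution* of unweighted vertex cover with hard capacities (VCHC) consists of $x_v\in\{0,\dots,m_v\}$ $(v\in V)$ and $y(e,v)\in\{0,1\}$ $(e\in E,\ v\in e)$ with $\sum_{v\in e}y(e,v)=1$ for all $e$ and $|\{e\in\delta(v):y(e,v)=1\}|\le k_vx_v$ for all $v$; its cost is $\sum_vx_v$. The relaxation **LP1** is $$\min\sum_{v\in V}x_v\quad\text{s.t.}\quad \sum_{v\in e}y(e,v)=1\ (e\in E),\quad y(e,v)\le x_v\ (e\in E, v\in e),\quad \sum_{e\in\delta(v)}y(e,v)\le k_vx_v,\quad x_v\le m_v\ (v\in V),\quad x,y\ge0 .$$ **Algorithm.** It maintains disjoint sets $T_u\subseteq E$ $(u\in V)$ with union $T$, a set $D\subseteq V$, partial values $\bar x,\bar y$, and a current LP solution $(x^*,y^*)$.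 Relative to $(x^*,y^*)$, put $U=\{u\in V\setminus D:x^*_u\ge 1/f\}$, $U_{>}=\{u\in V\setminus D: x^*_u>1/f\}$, $U_{=}=\{u\in V\setminus D:x^*_u=1/f\}$, $W=\{w\in V\setminus D:0<x_w^*<1/f\}$, $Z=\{z\in V\setminus D:x_z^*=0\}$. Initially all $T_u=\emptyset$, $D=\emptyset$, and $(x^*,y^*)$ is any optimal extreme point of LP1. Repeat the following iteration (at least once): 1. for every $v\in Z$ set $\bar x_v=0$, $\bar y(e,v)=0$ for $e\in\delta(v)$, and put $v$ into $D$; 2. if $y^*(e,u)=x^*_u$ for some $u\in U$ and $e\in\delta(u)\setminus T$, choose one such pair, set $\bar y(e,u)=1$, $\bar y(e,v)=0$ for $v\in e\setminus\{u\}$, and put $e$ into $T_u$; 3. for every $u\in U_{=}$ set $\bar x_u=1$, $\bar y(e,u)=y^*(e,u)$ for $e\in\delta(u)\setminus T$, and put $u$ into $D$; 4. replace $(x^*,y^*)$ by any optimal extreme point of the following **LP2**, in the variables $x_v$ $(v\notin D)$ and $y(e,v)$ $(e\notin T,\ v\in e\setminus D)$, where $U_>$ and $W$ are those of the old $(x^*,y^*)$;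 then update $U,U_>,U_=,W,Z$: $$\begin{aligned}\min\ &\textstyle\sum_{v\in V\setminus D}x_v\quad\text{s.t.}\\ &\textstyle\sum_{v\in e\setminus D}y(e,v)=1-\sum_{v\in e\cap D}\bar y(e,v)&&(e\in E\setminus T),\\ &y(e,v)\le x_v&&(e\in E\setminus T,\ v\in e\setminus D),\\ &\textstyle\sum_{e\in\delta(u)\setminus T}y(e,u)\le(k_u-|T_u|)x_u,\quad 1/f\le x_u\le m_u&&(u\in U_>),\\ &\textstyle\sum_{e\in\delta(w)\setminus T}y(e,w)\le k_wx_w,\quad 0\le x_w\le 1/f&&(w\in W),\\ &y\ge0;\end{aligned}$$ until $U_{=}=Z=\emptyset$ and $y^*(e,u)<x^*_u$ for all $u\in U$, $e\in\delta(u)\setminus T$. Finally, for $v\notin D$ set $\bar x_v=\lceil x_v^*\rceil$ and $\bar y(e,v)=y^*(e,v)$ for $e\in\delta(v)\setminus T$, and return $(\bar x,\bar y)$. **Theorem.** Suppose that LP1 is feasible. Then the algorithm is an $f$-approximation, for every choice of tight pairs and of optimal extreme points: - LP1 has an optimal extreme point, every LP2 that arises has an optimal extreme point, and every execution terminates after at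 most $|V|+|E|+1$ iterations (in particular, a terminating execution exists). - At termination, $|W|\le|U^{=}|$, where $U^{=}=\{u\in U:x_u^*=m_u\}$. - The returned $(\bar x,\bar y)$ is feasible for LP1 and $\bar x$ is integral; moreover there is an integral $y'$ such that $(\bar x,y')$ is a feasible solution of VCHC. - LP1 attains its minimum $\mathrm{OPT}(\mathrm{LP1})$, and $\sum_{v}\bar x_v\le f\cdot\mathrm{OPT}(\mathrm{LP1})$. Consequently $\sum_v\bar x_v\le f\cdot\sum_vx_v$ for every feasible solution $(x,y)$ of VCHC. -/

import Mathlib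

noncomputable section

namespace VCHC

/-- An instance of vertex cover with hard capacities on a finite multi-hypergraph: `ends e` is the
set of endpoints of the edge `e` (distinct edges may have the same endpoints), `k v` is the capacity
of one copy of `v`, and `m v` is the number of available copies of `v`. -/
structure Instance (V E : Type*) where
  ends : E → Finset V
  k : V → ℕ
  m : V → ℕ

/-- Every edge has at most `f` endpoints. -/
def Instance.IsHypergraph {V E : Type*} (I : Instance V E) (f : ℕ) : Prop :=
  ∀ e, (I.ends e).card ≤ f

open Classical in
/-- Feasible (integral) solutions: `x v` copies of `v` are selected, and `y e v = 1` means that `e`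
is assigned to its endpoint `v`. Values of `y` at non-incident pairs are irrelevant. -/
def Instance.IsSolution {V E : Type*} [Fintype V] [Fintype E] (I : Instance V E)
    (x : V → ℕ) (y : E → V → ℕ) : Prop :=
  (∀ v, x v ≤ I.m v) ∧
  (∀ e, ∀ v ∈ I.ends e, y e v = 0 ∨ y e v = 1) ∧
  (∀ e, ∑ v ∈ I.ends e, y e v = 1) ∧
  (∀ v, (Finset.univ.filter (fun e => v ∈ I.ends e ∧ y e v = 1)).card ≤ I.k v * x v)

/-- A pair `(x, y)` of real vectors. An LP that has fewer variables lives on the coordinate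
subspace on which all the coordinates that are not variables of the LP vanish. -/
abbrev Point (V E : Type*) := (V → ℝ) × (E → V → ℝ)

open Classical in
/-- The feasible region of the LP relaxation LP1. The last condition only removes the
coordinates `y e v` with `v ∉ e`, which are not variables. -/
def Instance.lp1 {V E : Type*} [Fintype V] [Fintype E] (I : Instance V E) : Set (Point V E) :=
  {p | (∀ e, ∑ v ∈ I.ends e, p.2 e v = 1) ∧
    (∀ e, ∀ v ∈ I.ends e, p.2 e v ≤ p.1 v) ∧
    (∀ v, ∑ e ∈ Finset.univ.filter (fun e => v ∈ I.ends e), p.2 e v ≤ (I.k v : ℝ) * p.1 v) ∧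
    (∀ v, p.1 v ≤ (I.m v : ℝ)) ∧
    (∀ v, 0 ≤ p.1 v) ∧
    (∀ e, ∀ v ∈ I.ends e, 0 ≤ p.2 e v) ∧
    (∀ e v, v ∉ I.ends e → p.2 e v = 0)}

/-- The objective of LP1. -/
def lp1Cost {V E : Type*} [Fintype V] (p : Point V E) : ℝ := ∑ v, p.1 v

/-- `p` is an extreme point of the region `P` that minimizes `c` over `P`. -/
def IsOptExtreme {V E : Type*} (P : Set (Point V E)) (c : Point V E → ℝ) (p : Point V E) : Prop :=
  p ∈ P.extremePoints ℝ ∧ ∀ q ∈ P, c p ≤ c q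

/-- The data kept by the algorithm: the sets `T u` of tight edges covered by `u`, the set `D` of
vertices whose value is determined, the partial solution `(xbar, ybar)`, and the current LP
solution `(xs, ys)`. -/
structure State (V E : Type*) where
  T : V → Finset E
  D : Finset V
  xbar : V → ℕ
  ybar : E → V → ℝ
  xs : V → ℝ
  ys : E → V → ℝ

namespace State

variable {V E : Type*}

/-- `e` is one of the tight edges. -/
def InT (s : State V E) (e : E) : Prop := ∃ u, e ∈ s.T u

/-! The classes of undetermined vertices with respect to the current LP solution. -/

open Classical in
/-- Undetermined vertices of value at least `1/f`. -/
def U [Fintype V] (s : State V E) (f : ℕ) : Finset V :=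
  Finset.univ.filter (fun v => v ∉ s.D ∧ 1 / (f : ℝ) ≤ s.xs v)

open Classical in
/-- Undetermined vertices of value greater than `1/f`. -/
def Ugt [Fintype V] (s : State V E) (f : ℕ) : Finset V :=
  Finset.univ.filter (fun v => v ∉ s.D ∧ 1 / (f : ℝ) < s.xs v)

open Classical in
/-- Undetermined vertices of value exactly `1/f`. -/
def Ueq [Fintype V] (s : State V E) (f : ℕ) : Finset V :=
  Finset.univ.filter (fun v => v ∉ s.D ∧ s.xs v = 1 / (f : ℝ))

open Classical in
/-- Undetermined vertices of value strictly between `0` and `1/f`. -/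
def W [Fintype V] (s : State V E) (f : ℕ) : Finset V :=
  Finset.univ.filter (fun v => v ∉ s.D ∧ 0 < s.xs v ∧ s.xs v < 1 / (f : ℝ))

open Classical in
/-- Undetermined vertices of value `0`. -/
def Z [Fintype V] (s : State V E) : Finset V :=
  Finset.univ.filter (fun v => v ∉ s.D ∧ s.xs v = 0)

open Classical in
/-- The vertices of `U` all of whose copies are selected by the current LP solution. -/
def Ufull [Fintype V] (s : State V E) (I : Instance V E) (f : ℕ) : Finset V :=
  (s.U f).filter (fun u => s.xs u = (I.m u : ℝ))

/-- The state before the first iteration, for a solution `p` of LP1. (The initial values of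
`xbar`, `ybar` at incident pairs are overwritten before they are ever read.) -/
def init (p : Point V E) : State V E where
  T := fun _ => ∅
  D := ∅
  xbar := fun _ => 0
  ybar := fun _ _ => 0
  xs := p.1
  ys := p.2

open Classical in
/-- First part of an iteration: every vertex of value `0` is determined, with value `0`. -/
def fixZ [Fintype V] (s : State V E) (I : Instance V E) : State V E where
  T := s.T
  D := s.D ∪ s.Z
  xbar := fun v => if v ∈ s.Z then 0 else s.xbar v
  ybar := fun e v => if v ∈ s.Z ∧ v ∈ I.ends e then 0 else s.ybar e v
  xs := s.xs
  ys := s.ys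

/-- The pair `(e, u)` is tight: `u ∈ U`, `e ∈ δ(u) \ T` and `y*(e,u) = x*_u`. -/
def TightPair [Fintype V] (s : State V E) (I : Instance V E) (f : ℕ) (e : E) (u : V) : Prop :=
  u ∈ s.U f ∧ u ∈ I.ends e ∧ ¬ s.InT e ∧ s.ys e u = s.xs u

open Classical in
/-- The edge `e` is covered by `u` and inserted into `T u`. -/
def cover (s : State V E) (I : Instance V E) (e : E) (u : V) : State V E where
  T := fun w => if w = u then insert e (s.T u) else s.T w
  D := s.D
  xbar := s.xbar
  ybar := fun e' v =>
    if e' = e ∧ v ∈ I.ends e then (if v = u then 1 else 0) else s.ybar e' v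
  xs := s.xs
  ys := s.ys

/-- Second part of an iteration: if there is a tight pair, one such pair (any) is processed;
otherwise nothing happens. -/
def TightStep [Fintype V] (s : State V E) (I : Instance V E) (f : ℕ) (s' : State V E) : Prop :=
  (∃ e u, s.TightPair I f e u ∧ s' = s.cover I e u) ∨
  ((∀ e u, ¬ s.TightPair I f e u) ∧ s' = s)

open Classical in
/-- Third part of an iteration: every vertex of value `1/f` is determined, with value `1`, and its
current assignment to non-tight edges is kept. -/
def fixU [Fintype V] (s : State V E) (I : Instance V E) (f : ℕ) : State V E where
  T := s.T
  D := s.D ∪ s.Ueq f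
  xbar := fun v => if v ∈ s.Ueq f then 1 else s.xbar v
  ybar := fun e v => if v ∈ s.Ueq f ∧ v ∈ I.ends e ∧ ¬ s.InT e then s.ys e v else s.ybar e v
  xs := s.xs
  ys := s.ys

open Classical in
/-- The feasible region of the modified relaxation LP2 that belongs to the state `s`. The vertex
classes are those of the previous LP solution, which is the one stored in `s`. The variables are
`x v` for `v ∉ D` and `y e v` for `e ∉ T`, `v ∈ e \ D`; the last two conditions remove the other
coordinates. -/
def lp2 [Fintype V] [Fintype E] (s : State V E) (I : Instance V E) (f : ℕ) :
    Set (Point V E) :=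
  {p | (∀ e, ¬ s.InT e →
      ∑ v ∈ I.ends e \ s.D, p.2 e v = 1 - ∑ v ∈ I.ends e ∩ s.D, s.ybar e v) ∧
    (∀ e, ¬ s.InT e → ∀ v ∈ I.ends e \ s.D, p.2 e v ≤ p.1 v) ∧
    (∀ u ∈ s.Ugt f, ∑ e ∈ Finset.univ.filter (fun e => u ∈ I.ends e ∧ ¬ s.InT e), p.2 e u
      ≤ ((I.k u : ℝ) - ((s.T u).card : ℝ)) * p.1 u) ∧
    (∀ w ∈ s.W f, ∑ e ∈ Finset.univ.filter (fun e => w ∈ I.ends e ∧ ¬ s.InT e), p.2 e w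
      ≤ (I.k w : ℝ) * p.1 w) ∧
    (∀ u ∈ s.Ugt f, 1 / (f : ℝ) ≤ p.1 u ∧ p.1 u ≤ (I.m u : ℝ)) ∧
    (∀ w ∈ s.W f, 0 ≤ p.1 w ∧ p.1 w ≤ 1 / (f : ℝ)) ∧
    (∀ e, ¬ s.InT e → ∀ v ∈ I.ends e \ s.D, 0 ≤ p.2 e v) ∧
    (∀ v ∈ s.D, p.1 v = 0) ∧
    (∀ e v, ¬ (¬ s.InT e ∧ v ∈ I.ends e \ s.D) → p.2 e v = 0)}

open Classical in
/-- The objective of LP2. -/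
def lp2Cost [Fintype V] (s : State V E) (p : Point V E) : ℝ :=
  ∑ v ∈ Finset.univ \ s.D, p.1 v

/-- One iteration of the loop: the three parts above, and then any optimal extreme point of the
updated LP2 becomes the current LP solution. -/
def Iter [Fintype V] [Fintype E] (s : State V E) (I : Instance V E) (f : ℕ)
    (s' : State V E) : Prop :=
  ∃ s₁ : State V E, (s.fixZ I).TightStep I f s₁ ∧
    ∃ p : Point V E, IsOptExtreme ((s₁.fixU I f).lp2 I f) (s₁.fixU I f).lp2Cost p ∧
      s' = { s₁.fixU I f with xs := p.1, ys := p.2 }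

/-- The exit condition of the loop. -/
def Stop [Fintype V] (s : State V E) (I : Instance V E) (f : ℕ) : Prop :=
  s.Ueq f = ∅ ∧ s.Z = ∅ ∧
    ∀ u ∈ s.U f, ∀ e, u ∈ I.ends e → ¬ s.InT e → s.ys e u < s.xs u

open Classical in
/-- The integral vector returned from the state `s`: undetermined vertices are rounded up. -/
def outX (s : State V E) (v : V) : ℕ :=
  if v ∈ s.D then s.xbar v else ⌈s.xs v⌉₊

open Classical in
/-- The assignment returned from the state `s`. -/
def outY (s : State V E) (I : Instance V E) (e : E) (v : V) : ℝ :=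
  if v ∉ s.D ∧ v ∈ I.ends e ∧ ¬ s.InT e then s.ys e v else s.ybar e v

end State

/-- `Reach I f n s`: in some execution of the algorithm on `I`, the state after `n` iterations is
`s`. The loop is of type `repeat ... until`, so that the first iteration is always performed and
the exit condition is tested after each iteration. -/
inductive Reach {V E : Type*} [Fintype V] [Fintype E] (I : Instance V E) (f : ℕ) :
    ℕ → State V E → Prop
  | start (p : Point V E) (hp : IsOptExtreme I.lp1 lp1Cost p) : Reach I f 0 (State.init p)
  | step (n : ℕ) (s s' : State V E) (hs : Reach I f n s) (hn : n = 0 ∨ ¬ s.Stop I f)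
      (hs' : s.Iter I f s') : Reach I f (n + 1) s'

/-- Some execution of the algorithm terminates in the state `s`. -/
def Terminates {V E : Type*} [Fintype V] [Fintype E] (I : Instance V E) (f : ℕ)
    (s : State V E) : Prop :=
  ∃ n, 1 ≤ n ∧ Reach I f n s ∧ s.Stop I f

end VCHC

end

/-! The algorithm never leaves a single fractional picture. Give an undetermined vertex its current
LP value and a determined vertex $\bar x_v/f$; delete the tight edges and charge each of them one
unit of capacity at its covering vertex. This fractional solution (`State.val`, `State.asg`) stays
feasible for the residual instance, and its cost never exceeds $\mathrm{OPT}(\mathrm{LP1})$; this is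
the invariant `State.Inv`. Fixing a vertex at value $0$ or $1/f$ does not change the picture.
Covering a tight edge lowers both sides of the capacity inequality at its vertex by the same
$x^*_u$. Re-solving can only lower the cost, because the old solution is feasible for LP2.

Feasibility of the output follows by rounding all values up. An LP1 solution with integral $x$ gives
an integral assignment by Hall's theorem.

For the cost, compare $\lceil x_v\rceil$ with $f x_v$ at termination. A vertex of $W$ may lose up to
$1$, a fully selected vertex of $U$ gains at least $1$, and no other vertex loses. Hence it suffices
that $|W|\le|U^{=}|$ (`State.Inv.card_W_le`).

That inequality is a rank count at an extreme point of LP2. Call $(e,v)$ free if $y(e,v)$ is neither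
$0$ nor $x_v$. Every edge that still has a variable has a free pair in $U$
(`State.Inv.exists_free`), so the edge equations are paid for by free pairs in $U$, and the capacity
constraints of those $w\in W$ that lie in a free pair are paid for by free pairs in $W$. A capacity
constraint of a $w$ without free pairs follows from the constraints $y=0$ and $y=x_w$. The
coordinates $x_v$ pay for the determined vertices and for the capacities of $U$, with $|W|$ of them
left over. Only the constraints $x_u=m_u$ remain, so $|U^{=}|<|W|$ would leave a nonzero direction
along which the extreme point could move.

Termination: an iteration that starts from a state violating the exit condition determines a vertex
or adds a tight edge. -/

noncomputable section

namespace VCHC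

variable {V E : Type*}

section

/-! ### Existence of optimal extreme points by compactness. -/

section Existence

/-- The linear functional that sums the `x`-coordinates over a finite set of vertices. -/
def sumX (s : Finset V) : Point V E →L[ℝ] ℝ :=
  ∑ v ∈ s, (ContinuousLinearMap.proj (R := ℝ) (φ := fun _ : V => ℝ) v).comp
    (ContinuousLinearMap.fst ℝ (V → ℝ) (E → V → ℝ))

theorem sumX_apply (s : Finset V) (p : Point V E) : sumX s p = ∑ v ∈ s, p.1 v := by
  simp [sumX]

variable [Fintype V] [Fintype E]

/-- A closed bounded nonempty region of points has an extreme point minimizing a given linear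
functional. -/
theorem exists_isOptExtreme {P : Set (Point V E)} (hc : IsClosed P) {B : ℝ} (hB : 0 ≤ B)
    (h1 : ∀ p ∈ P, ∀ v, |p.1 v| ≤ B) (h2 : ∀ p ∈ P, ∀ e v, |p.2 e v| ≤ B) (hne : P.Nonempty)
    (l : Point V E →L[ℝ] ℝ) : ∃ p, IsOptExtreme P l p := by
  have hcomp : IsCompact P := by
    refine Metric.isCompact_of_isClosed_isBounded hc
      ((Metric.isBounded_closedBall (x := (0 : Point V E)) (r := B)).subset fun p hp => ?_)
    rw [mem_closedBall_zero_iff, norm_prod_le_iff]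
    refine ⟨(pi_norm_le_iff_of_nonneg hB).2 fun v => h1 p hp v,
      (pi_norm_le_iff_of_nonneg hB).2 fun e => (pi_norm_le_iff_of_nonneg hB).2 fun v => h2 p hp e v⟩
  obtain ⟨p₀, hp₀, hmin⟩ := hcomp.exists_isMinOn hne l.continuous.continuousOn
  -- The minimizers of `l` form an exposed face. The face is compact, so it has an extreme point,
  -- which is also extreme in `P`.
  have hexp : IsExposed ℝ P {x | x ∈ P ∧ ∀ y ∈ P, (-l) y ≤ (-l) x} := fun _ => ⟨-l, rfl⟩
  obtain ⟨p, hp⟩ := (hexp.isCompact hcomp).extremePoints_nonempty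
    ⟨p₀, hp₀, fun y hy => by simpa using hmin hy⟩
  refine ⟨p, hexp.isExtreme.extremePoints_subset_extremePoints hp, fun q hq => ?_⟩
  simpa using hp.1.2 q hq

theorem Instance.isClosed_lp1 (I : Instance V E) : IsClosed I.lp1 := by
  unfold Instance.lp1
  simp only [Set.ofPred_and, Set.ofPred_forall]
  repeat' first
    | exact isClosed_le (by fun_prop) (by fun_prop)
    | exact isClosed_eq (by fun_prop) (by fun_prop)
    | refine IsClosed.inter ?_ ?_
    | refine isClosed_iInter fun _ => ?_

theorem State.isClosed_lp2 (I : Instance V E) (f : ℕ) (s : State V E) :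
    IsClosed (s.lp2 I f) := by
  unfold State.lp2
  simp only [Set.ofPred_and, Set.ofPred_forall]
  repeat' first
    | exact isClosed_le (by fun_prop) (by fun_prop)
    | exact isClosed_eq (by fun_prop) (by fun_prop)
    | refine IsClosed.inter ?_ ?_
    | refine isClosed_iInter fun _ => ?_

theorem Instance.exists_isOptExtreme_lp1 (I : Instance V E) (h : I.lp1.Nonempty) :
    ∃ p, IsOptExtreme I.lp1 lp1Cost p := by
  have hm : ∀ v, (I.m v : ℝ) ≤ ∑ v, (I.m v : ℝ) := fun v =>
    Finset.single_le_sum (f := fun v => (I.m v : ℝ)) (fun _ _ => Nat.cast_nonneg _)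
      (Finset.mem_univ v)
  have hB : (0 : ℝ) ≤ ∑ v, (I.m v : ℝ) := Finset.sum_nonneg fun _ _ => Nat.cast_nonneg _
  suffices hs : _ ∧ _ by
    obtain ⟨p, hp⟩ := exists_isOptExtreme I.isClosed_lp1 hB hs.1 hs.2 h (sumX Finset.univ)
    exact ⟨p, hp.1, fun q hq => by simpa [sumX_apply, lp1Cost] using hp.2 q hq⟩
  constructor
  · rintro p ⟨-, -, -, h4, h5, -, -⟩ v
    rw [abs_of_nonneg (h5 v)]
    exact (h4 v).trans (hm v)
  · rintro p ⟨-, h2, -, h4, h5, h6, h7⟩ e v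
    by_cases hv : v ∈ I.ends e
    · rw [abs_of_nonneg (h6 e v hv)]
      exact ((h2 e v hv).trans (h4 v)).trans (hm v)
    · rw [h7 e v hv, abs_zero]
      exact hB

/-- LP2 bounds $x_v$ only through the class of $v$: by $m_v$ on $U_>$ and by $1/f$ on $W$.
Boundedness therefore needs every undetermined vertex to be in one of the two. -/
theorem State.exists_isOptExtreme_lp2 (I : Instance V E) {f : ℕ} (s : State V E)
    (hcl : ∀ v, v ∉ s.D → v ∈ s.Ugt f ∨ v ∈ s.W f) (h : (s.lp2 I f).Nonempty) :
    ∃ p, IsOptExtreme (s.lp2 I f) s.lp2Cost p := by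
  classical
  have hm : ∀ v, (I.m v : ℝ) ≤ ∑ v, (I.m v : ℝ) := fun v =>
    Finset.single_le_sum (f := fun v => (I.m v : ℝ)) (fun _ _ => Nat.cast_nonneg _)
      (Finset.mem_univ v)
  have hB : (0 : ℝ) ≤ ∑ v, (I.m v : ℝ) := Finset.sum_nonneg fun _ _ => Nat.cast_nonneg _
  have hf : (0 : ℝ) ≤ 1 / f := by positivity
  have hx : ∀ p ∈ s.lp2 I f, ∀ v, |p.1 v| ≤ ∑ v, (I.m v : ℝ) + 1 / f := by
    rintro p ⟨-, -, -, -, h5, h6, -, h8, -⟩ v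
    by_cases hv : v ∈ s.D
    · rw [h8 v hv, abs_zero]; linarith
    rcases hcl v hv with hv | hv
    · rw [abs_of_nonneg (hf.trans (h5 v hv).1)]
      linarith [(h5 v hv).2, hm v]
    · rw [abs_of_nonneg (h6 v hv).1]
      linarith [(h6 v hv).2]
  have hy : ∀ p ∈ s.lp2 I f, ∀ e v, |p.2 e v| ≤ ∑ v, (I.m v : ℝ) + 1 / f := by
    intro p hp e v
    have hxv := hx p hp v
    obtain ⟨-, h2, -, -, -, -, h7, -, h9⟩ := hp
    by_cases hv : ¬ s.InT e ∧ v ∈ I.ends e \ s.D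
    · rw [abs_of_nonneg (h7 e hv.1 v (by convert hv.2))]
      exact ((h2 e hv.1 v (by convert hv.2)).trans (le_abs_self _)).trans hxv
    · rw [h9 e v (by convert hv), abs_zero]
      linarith
  obtain ⟨p, hp⟩ := exists_isOptExtreme (s.isClosed_lp2 I f) (by linarith) hx hy h
    (sumX (Finset.univ \ s.D))
  exact ⟨p, hp.1, fun q hq => by simpa only [sumX_apply, State.lp2Cost] using hp.2 q hq⟩

end Existence

/-! ### LP1 solutions with integral $x$ versus integral solutions. -/

section Integral

variable [Fintype V] [Fintype E]

/-- An LP1 solution with integral `x` can be made integral, by Hall's theorem. -/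
theorem Instance.exists_isSolution_of_mem_lp1 (I : Instance V E) {x : V → ℕ} {y : E → V → ℝ}
    (h : ((fun v => (x v : ℝ)), y) ∈ I.lp1) (hx : ∀ v, x v ≤ I.m v) :
    ∃ y', I.IsSolution x y' := by
  classical
  obtain ⟨h1, -, h3, -, -, h6, h7⟩ := h
  dsimp only at h1 h3 h6 h7
  have hy0 : ∀ e v, 0 ≤ y e v := fun e v => by
    by_cases hv : v ∈ I.ends e
    · exact h6 e v hv
    · exact (h7 e v hv).ge
  -- Each vertex offers $k_vx_v$ slots, and an edge may use any slot of its endpoints. Hall's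
  -- condition for a set of edges comes from adding up their fractional assignments.
  let t : E → Finset (Σ v, Fin (I.k v * x v)) := fun e =>
    Finset.univ.filter fun a => a.1 ∈ I.ends e
  obtain ⟨g, hg, hgt⟩ := (Finset.all_card_le_biUnion_card_iff_exists_injective t).1 fun A => by
    set N := A.biUnion I.ends with hN
    have hsub : (N.sigma fun v => (Finset.univ : Finset (Fin (I.k v * x v)))) ⊆ A.biUnion t := by
      intro a ha
      simp only [hN, Finset.mem_sigma, Finset.mem_biUnion, Finset.mem_univ, and_true] at ha
      simpa [t] using ha
    refine le_trans ?_ (Finset.card_le_card hsub)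
    rw [Finset.card_sigma]
    simp only [Finset.card_univ, Fintype.card_fin]
    have key : (A.card : ℝ) ≤ ∑ v ∈ N, (I.k v : ℝ) * x v := by
      calc (A.card : ℝ) = ∑ e ∈ A, ∑ v ∈ I.ends e, y e v := by simp [h1]
        _ = ∑ e ∈ A, ∑ v ∈ N, y e v := Finset.sum_congr rfl fun e he =>
            Finset.sum_subset (Finset.subset_biUnion_of_mem I.ends he) fun v _ hv => h7 e v hv
        _ = ∑ v ∈ N, ∑ e ∈ A, y e v := Finset.sum_comm
        _ ≤ ∑ v ∈ N, (I.k v : ℝ) * x v := Finset.sum_le_sum fun v _ => by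
            refine le_trans ?_ (h3 v)
            rw [Finset.sum_filter_of_ne (fun e _ hne => not_imp_comm.1 (h7 e v) hne)]
            exact Finset.sum_le_univ_sum_of_nonneg fun e => hy0 e v
    exact_mod_cast key
  have hmem : ∀ e, (g e).1 ∈ I.ends e := fun e => by simpa [t] using hgt e
  refine ⟨fun e v => if v = (g e).1 then 1 else 0, hx, fun e v _ => ?_, fun e => ?_, fun v => ?_⟩
  · dsimp only
    split_ifs <;> simp
  · simp [hmem e]
  · have : ((Finset.univ : Finset (Fin (I.k v * x v))).map
        (Function.Embedding.sigmaMk (β := fun v => Fin (I.k v * x v)) v)).card = I.k v * x v := by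
      simp
    rw [← this]
    refine Finset.card_le_card_of_injOn g (fun e he => ?_) hg.injOn
    have hev : v = (g e).1 := by
      by_contra hne
      simp [hne] at he
    subst hev
    simp only [Finset.coe_map, Set.mem_image, Finset.coe_univ, Set.mem_univ, true_and]
    exact ⟨(g e).2, rfl⟩

/-- Feasible integral solutions are feasible for LP1. -/
theorem Instance.IsSolution.exists_mem_lp1 {I : Instance V E} {x : V → ℕ} {y : E → V → ℕ}
    (h : I.IsSolution x y) : ∃ y' : E → V → ℝ, ((fun v => (x v : ℝ)), y') ∈ I.lp1 := by
  classical
  obtain ⟨h1, h2, h3, h4⟩ := h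
  have hle : ∀ e, ∀ v ∈ I.ends e, y e v ≤ x v := fun e v hv => by
    rcases h2 e v hv with h0 | h0
    · simp [h0]
    · rw [h0, Nat.one_le_iff_ne_zero]
      intro hx
      have := h4 v
      rw [hx, mul_zero, Nat.le_zero, Finset.card_eq_zero] at this
      exact Finset.notMem_empty e (this ▸ by simp [hv, h0])
  refine ⟨fun e v => if v ∈ I.ends e then (y e v : ℝ) else 0, fun e => ?_, fun e v hv => ?_,
    fun v => ?_, fun v => ?_, fun v => ?_, fun e v hv => ?_, fun e v hv => ?_⟩
  · rw [Finset.sum_congr rfl fun v hv => if_pos hv]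
    exact_mod_cast h3 e
  · simpa [hv] using hle e v hv
  · have hcard : ∑ e ∈ Finset.univ.filter (fun e => v ∈ I.ends e), y e v =
        (Finset.univ.filter (fun e => v ∈ I.ends e ∧ y e v = 1)).card := by
      rw [← Finset.filter_filter, Finset.card_filter]
      refine Finset.sum_congr rfl fun e he => ?_
      rcases h2 e v (Finset.mem_filter.1 he).2 with h0 | h0 <;> simp [h0]
    have := h4 v
    rw [Finset.sum_congr rfl fun e he => if_pos (Finset.mem_filter.1 he).2]
    refine le_trans (le_of_eq ?_) (Nat.cast_le.2 this |>.trans_eq (Nat.cast_mul _ _))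
    rw [← Nat.cast_sum]
    exact_mod_cast congrArg Nat.cast hcard
  · exact Nat.cast_le.2 (h1 v)
  · exact Nat.cast_nonneg _
  · simp [hv]
  · simp [hv]

end Integral

end

/-! ### The loop invariant and its preservation before LP2 is solved. -/

section

namespace State

open Classical in
/-- The value of a vertex in the maintained fractional solution: the current LP value if it is
undetermined, and the `f`-th part of the determined value otherwise. -/
def val (s : State V E) (f : ℕ) (v : V) : ℝ := if v ∈ s.D then (s.xbar v : ℝ) / f else s.xs v

open Classical in
/-- The assignment of the non-tight edges in the maintained fractional solution. -/
def asg (s : State V E) (e : E) (v : V) : ℝ := if v ∈ s.D then s.ybar e v else s.ys e v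

open Classical in
/-- The loop invariant: `val` and `asg` form a fractional solution of cost at most `c` for the
residual instance in which the tight edges are deleted and each of them uses up one unit of the
capacity of the vertex that covers it. -/
structure Inv [Fintype V] [Fintype E] (s : State V E) (I : Instance V E) (f : ℕ) (c : ℝ) :
    Prop where
  disj : ∀ {e u v}, e ∈ s.T u → e ∈ s.T v → u = v
  inc : ∀ {e u}, e ∈ s.T u → u ∈ I.ends e
  ybar_tight : ∀ {e u v}, e ∈ s.T u → v ∈ I.ends e → s.ybar e v = if v = u then 1 else 0
  ybar_off : ∀ {e v}, v ∉ I.ends e → s.ybar e v = 0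
  val_tight : ∀ {e u}, e ∈ s.T u → 1 / (f : ℝ) ≤ s.val f u
  xbar_le : ∀ {v}, v ∈ s.D → s.xbar v ≤ 1
  sum_asg : ∀ {e}, ¬ s.InT e → ∑ v ∈ I.ends e, s.asg e v = 1
  asg_nonneg : ∀ {e v}, ¬ s.InT e → v ∈ I.ends e → 0 ≤ s.asg e v
  asg_le : ∀ {e v}, ¬ s.InT e → v ∈ I.ends e → s.asg e v ≤ s.val f v
  load : ∀ v, ∑ e ∈ Finset.univ.filter (fun e => v ∈ I.ends e ∧ ¬ s.InT e), s.asg e v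
    ≤ ((I.k v : ℝ) - ((s.T v).card : ℝ)) * s.val f v
  val_nonneg : ∀ v, 0 ≤ s.val f v
  val_le : ∀ v, s.val f v ≤ I.m v
  cost : ∑ v, s.val f v ≤ c

variable [Fintype V] [Fintype E] {s : State V E} {I : Instance V E} {f : ℕ} {c : ℝ}

open Classical in
/-- The invariant only depends on the values of vertices, the tight edges, and the assignment of
the non-tight edges. -/
theorem Inv.congr {t : State V E} (h : s.Inv I f c) (hT : t.T = s.T)
    (hval : ∀ v, t.val f v = s.val f v)
    (hasg : ∀ e v, ¬ s.InT e → v ∈ I.ends e → t.asg e v = s.asg e v)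
    (htight : ∀ {e u v}, e ∈ s.T u → v ∈ I.ends e → t.ybar e v = if v = u then 1 else 0)
    (hoff : ∀ {e v}, v ∉ I.ends e → t.ybar e v = 0)
    (hx : ∀ {v}, v ∈ t.D → t.xbar v ≤ 1) : t.Inv I f c := by
  have hInT : ∀ e, t.InT e ↔ s.InT e := fun e => by simp [InT, hT]
  refine ⟨fun {e u v} h1 h2 => ?_, fun {e u} h1 => ?_, fun {e u v} h1 => ?_, hoff,
    fun {e u} h1 => ?_, hx, fun {e} he => ?_, fun {e v} he hv => ?_, fun {e v} he hv => ?_,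
    fun v => ?_, fun v => ?_, fun v => ?_, ?_⟩
  · rw [hT] at h1 h2; exact h.disj h1 h2
  · rw [hT] at h1; exact h.inc h1
  · rw [hT] at h1; exact htight h1
  · rw [hT] at h1; rw [hval]; exact h.val_tight h1
  · rw [hInT] at he
    rw [Finset.sum_congr rfl fun v hv => hasg e v he hv]
    exact h.sum_asg he
  · rw [hInT] at he
    rw [hasg e v he hv]; exact h.asg_nonneg he hv
  · rw [hInT] at he
    rw [hasg e v he hv, hval]; exact h.asg_le he hv
  · rw [hval, hT]
    refine (Finset.sum_congr (Finset.filter_congr fun e _ => by rw [hInT])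
      fun e he => ?_).trans_le (h.load v)
    have := (Finset.mem_filter.1 he).2
    exact hasg e v this.2 this.1
  · rw [hval]; exact h.val_nonneg v
  · rw [hval]; exact h.val_le v
  · simp only [hval]; exact h.cost

omit [Fintype E] in
theorem mem_Z {v : V} : v ∈ s.Z ↔ v ∉ s.D ∧ s.xs v = 0 := by simp [Z]

omit [Fintype E] in
theorem mem_U {v : V} : v ∈ s.U f ↔ v ∉ s.D ∧ 1 / (f : ℝ) ≤ s.xs v := by simp [U]

omit [Fintype E] in
theorem mem_Ueq {v : V} : v ∈ s.Ueq f ↔ v ∉ s.D ∧ s.xs v = 1 / (f : ℝ) := by simp [Ueq]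

omit [Fintype E] in
theorem mem_Ugt {v : V} : v ∈ s.Ugt f ↔ v ∉ s.D ∧ 1 / (f : ℝ) < s.xs v := by simp [Ugt]

omit [Fintype E] in
theorem mem_W {v : V} : v ∈ s.W f ↔ v ∉ s.D ∧ 0 < s.xs v ∧ s.xs v < 1 / (f : ℝ) := by simp [W]

omit [Fintype V] [Fintype E] in
theorem val_of_mem {v : V} (h : v ∈ s.D) : s.val f v = (s.xbar v : ℝ) / f := if_pos h

omit [Fintype V] [Fintype E] in
theorem val_of_notMem {v : V} (h : v ∉ s.D) : s.val f v = s.xs v := if_neg h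

omit [Fintype V] [Fintype E] in
theorem asg_of_mem {e : E} {v : V} (h : v ∈ s.D) : s.asg e v = s.ybar e v := if_pos h

omit [Fintype V] [Fintype E] in
theorem asg_of_notMem {e : E} {v : V} (h : v ∉ s.D) : s.asg e v = s.ys e v := if_neg h

/-- The value stays $0=0/f$, and the assignments of non-tight edges to such a vertex are already
squeezed to $0$ by $0\le y\le x$. A vertex that covers a tight edge has value at least $1/f$, so no
cover is overwritten. -/
theorem Inv.fixZ (h : s.Inv I f c) (hf : 0 < f) : (s.fixZ I).Inv I f c := by
  classical
  have hf' : (0 : ℝ) < 1 / f := by positivity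
  have hD : ∀ v, v ∈ (s.fixZ I).D ↔ v ∈ s.D ∨ v ∈ s.Z := fun v => by simp [State.fixZ]
  have hZD : ∀ v, v ∈ s.Z → v ∉ s.D := fun v hv => (mem_Z.1 hv).1
  refine h.congr rfl (fun v => ?_) (fun e v he hv => ?_) (fun {e u v} he hv => ?_)
    (fun {e v} hv => ?_) (fun {v} hv => ?_)
  · by_cases hZ : v ∈ s.Z
    · rw [val_of_mem ((hD v).2 (.inr hZ)), val_of_notMem (hZD v hZ), (mem_Z.1 hZ).2]
      simp [State.fixZ, hZ]
    · simp [val, hZ, State.fixZ]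
  · by_cases hZ : v ∈ s.Z
    · have h1 := h.asg_nonneg he hv
      have h2 := h.asg_le he hv
      rw [val_of_notMem (hZD v hZ), (mem_Z.1 hZ).2] at h2
      rw [asg_of_mem ((hD v).2 (.inr hZ)), le_antisymm h2 h1]
      simp [State.fixZ, hZ, hv]
    · simp [asg, hZ, State.fixZ]
  · by_cases hZ : v ∈ s.Z
    · have hvu : v ≠ u := by
        rintro rfl
        have := h.val_tight he
        rw [val_of_notMem (hZD v hZ), (mem_Z.1 hZ).2] at this
        linarith
      simp [State.fixZ, hZ, hv, hvu]
    · simpa [State.fixZ, hZ] using h.ybar_tight he hv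
  · simpa [State.fixZ, hv] using h.ybar_off hv
  · by_cases hZ : v ∈ s.Z
    · simp [State.fixZ, hZ]
    · simpa [State.fixZ, hZ] using h.xbar_le (((hD v).1 hv).resolve_right hZ)

/-- Setting $\bar x_u=1$ keeps the maintained value, since $\bar x_u/f=1/f=x^*_u$. -/
theorem Inv.fixU (h : s.Inv I f c) : (s.fixU I f).Inv I f c := by
  classical
  have hD : ∀ v, v ∈ (s.fixU I f).D ↔ v ∈ s.D ∨ v ∈ s.Ueq f := fun v => by simp [State.fixU]
  have hUD : ∀ v, v ∈ s.Ueq f → v ∉ s.D := fun v hv => (mem_Ueq.1 hv).1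
  refine h.congr rfl (fun v => ?_) (fun e v he hv => ?_) (fun {e u v} he hv => ?_)
    (fun {e v} hv => ?_) (fun {v} hv => ?_)
  · by_cases hU : v ∈ s.Ueq f
    · rw [val_of_mem ((hD v).2 (.inr hU)), val_of_notMem (hUD v hU), (mem_Ueq.1 hU).2]
      simp [State.fixU, hU]
    · simp [val, hU, State.fixU]
  · by_cases hU : v ∈ s.Ueq f
    · rw [asg_of_mem ((hD v).2 (.inr hU)), asg_of_notMem (hUD v hU)]
      simp [State.fixU, hU, hv, he]
    · simp [asg, hU, State.fixU]
  · have : s.InT e := ⟨u, he⟩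
    simpa [State.fixU, this] using h.ybar_tight he hv
  · simpa [State.fixU, hv] using h.ybar_off hv
  · by_cases hU : v ∈ s.Ueq f
    · simp [State.fixU, hU]
    · simpa [State.fixU, hU] using h.xbar_le (((hD v).1 hv).resolve_right hU)

omit [Fintype V] [Fintype E] in
theorem cover_T (s : State V E) (I : Instance V E) (e : E) (u w : V) (e' : E) :
    e' ∈ (s.cover I e u).T w ↔ e' ∈ s.T w ∨ (w = u ∧ e' = e) := by
  classical
  by_cases hw : w = u
  · subst hw; simp [cover, or_comm]
  · simp [cover, hw]

omit [Fintype V] [Fintype E] in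
theorem cover_InT (s : State V E) (I : Instance V E) (e : E) (u : V) (e' : E) :
    (s.cover I e u).InT e' ↔ s.InT e' ∨ e' = e := by
  simp [InT, cover_T, exists_or]

/-- At $u$ the load loses $y^*(e,u)=x^*_u$, exactly what the bound $(k_u-|T_u|)x^*_u$ loses when
$|T_u|$ grows by one. At other vertices the load does not increase. -/
theorem Inv.cover (h : s.Inv I f c) {e : E} {u : V} (htp : s.TightPair I f e u) :
    (s.cover I e u).Inv I f c := by
  classical
  obtain ⟨hu, hue, heT, htight⟩ := htp
  rw [mem_U] at hu
  have hval : ∀ v, (s.cover I e u).val f v = s.val f v := fun v => rfl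
  have hasg : ∀ e' v, e' ≠ e → (s.cover I e u).asg e' v = s.asg e' v := fun e' v hne => by
    simp [asg, State.cover, hne]
  have hne : ∀ {e' w}, e' ∈ s.T w → e' ≠ e := fun h1 h2 => heT ⟨_, h2 ▸ h1⟩
  refine ⟨fun {e' u v} h1 h2 => ?_, fun {e' w} h1 => ?_, fun {e' w v} h1 hv => ?_,
    fun {e' v} hv => ?_, fun {e' w} h1 => ?_, h.xbar_le, fun {e'} he => ?_, fun {e' v} he hv => ?_,
    fun {e' v} he hv => ?_, fun v => ?_, h.val_nonneg, h.val_le, h.cost⟩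
  · rw [cover_T] at h1 h2
    rcases h1 with h1 | h1 <;> rcases h2 with h2 | h2
    · exact h.disj h1 h2
    · exact absurd h2.2 (hne h1)
    · exact absurd h1.2 (hne h2)
    · exact h1.1.trans h2.1.symm
  · rw [cover_T] at h1
    rcases h1 with h1 | ⟨rfl, rfl⟩
    · exact h.inc h1
    · exact hue
  · rw [cover_T] at h1
    rcases h1 with h1 | ⟨rfl, rfl⟩
    · simpa [State.cover, hne h1] using h.ybar_tight h1 hv
    · simp [State.cover, hv]
  · have : ¬ (e' = e ∧ v ∈ I.ends e) := by rintro ⟨rfl, h2⟩; exact hv h2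
    simpa [State.cover, this] using h.ybar_off hv
  · rw [cover_T] at h1
    rcases h1 with h1 | ⟨rfl, rfl⟩
    · exact h.val_tight h1
    · rw [hval, val_of_notMem hu.1]; exact hu.2
  · rw [cover_InT, not_or] at he
    simp only [hasg e' _ he.2]
    exact h.sum_asg he.1
  · rw [cover_InT, not_or] at he
    rw [hasg e' _ he.2]
    exact h.asg_nonneg he.1 hv
  · rw [cover_InT, not_or] at he
    rw [hasg e' _ he.2]
    exact h.asg_le he.1 hv
  · have hsum : ∑ e' ∈ Finset.univ.filter (fun e' => v ∈ I.ends e' ∧ ¬ (s.cover I e u).InT e'),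
        (s.cover I e u).asg e' v =
        ∑ e' ∈ (Finset.univ.filter (fun e' => v ∈ I.ends e' ∧ ¬ s.InT e')).erase e,
          s.asg e' v := by
      refine Finset.sum_congr ?_ fun e' he' => hasg e' v (Finset.ne_of_mem_erase he')
      ext e'
      simp only [cover_InT, Finset.mem_filter, Finset.mem_univ, true_and, Finset.mem_erase]
      tauto
    have hl := h.load v
    rw [hsum, hval]
    by_cases hvu : v = u
    · subst hvu
      have hmem : e ∈ Finset.univ.filter (fun e' => v ∈ I.ends e' ∧ ¬ s.InT e') := by
        simp [hue, heT]
      have hcard : ((s.cover I e v).T v).card = (s.T v).card + 1 := by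
        rw [← Finset.card_insert_of_notMem (s := s.T v) (a := e) fun h1 => heT ⟨v, h1⟩]
        simp [State.cover]
      rw [← Finset.add_sum_erase _ _ hmem, asg_of_notMem hu.1, htight] at hl
      rw [hcard, val_of_notMem hu.1]
      rw [val_of_notMem hu.1] at hl
      push_cast
      linarith
    · have hT : (s.cover I e u).T v = s.T v := by simp [State.cover, hvu]
      rw [hT]
      refine le_trans (Finset.sum_le_sum_of_subset_of_nonneg (Finset.erase_subset _ _) ?_) hl
      intro e' he' _
      have := (Finset.mem_filter.1 he').2
      exact h.asg_nonneg this.2 this.1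

theorem Inv.tightStep (h : s.Inv I f c) {t : State V E} (ht : s.TightStep I f t) :
    t.Inv I f c := by
  rcases ht with ⟨e, u, h1, rfl⟩ | ⟨-, rfl⟩
  · exact h.cover h1
  · exact h

omit [Fintype E] in
theorem exists_tightStep (s : State V E) (I : Instance V E) (f : ℕ) :
    ∃ t, s.TightStep I f t := by
  by_cases h : ∃ e u, s.TightPair I f e u
  · obtain ⟨e, u, h⟩ := h
    exact ⟨_, .inl ⟨e, u, h, rfl⟩⟩
  · push Not at h
    exact ⟨s, .inr ⟨h, rfl⟩⟩

open Classical in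
theorem inv_init {p : Point V E} (hp : p ∈ I.lp1) : (init p).Inv I f (lp1Cost p) := by
  obtain ⟨h1, h2, h3, h4, h5, h6, h7⟩ := hp
  have hval : ∀ v, (init p).val f v = p.1 v := fun v => val_of_notMem (s := init p) (by simp [init])
  have hasg : ∀ e v, (init p).asg e v = p.2 e v := fun e v =>
    asg_of_notMem (s := init p) (by simp [init])
  have hT : ∀ v, (init p).T v = ∅ := fun v => rfl
  have hInT : ∀ e, ¬ (init p).InT e := fun e => by simp [InT, hT]
  have hload : ∀ v, ∑ e ∈ Finset.univ.filter (fun e => v ∈ I.ends e ∧ ¬ (init p).InT e),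
      (init p).asg e v ≤ ((I.k v : ℝ) - (((init p).T v).card : ℝ)) * (init p).val f v := by
    intro v
    rw [hT, hval, Finset.card_empty, Nat.cast_zero, sub_zero]
    refine (Finset.sum_congr (Finset.filter_congr fun e _ => ?_)
      fun e he => hasg e v).trans_le (h3 v)
    simp [hInT]
  constructor
  case load => exact hload
  all_goals simp_all [lp1Cost, init]

end State

end

/-! ### One iteration: passing to LP2, and progress. -/

section

namespace State

/-- Replace the current LP solution. -/
def setSol (t : State V E) (p : Point V E) : State V E := { t with xs := p.1, ys := p.2 }

open Classical in
/-- The current LP solution, restricted to the variables of LP2. -/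
def restrict (t : State V E) (I : Instance V E) : Point V E :=
  (fun v => if v ∈ t.D then 0 else t.xs v,
    fun e v => if ¬ t.InT e ∧ v ∈ I.ends e \ t.D then t.ys e v else 0)

/-- All undetermined vertices belong to one of the two vertex classes of LP2. -/
def Classified [Fintype V] (t : State V E) (f : ℕ) : Prop := ∀ v, v ∉ t.D → v ∈ t.Ugt f ∨ v ∈ t.W f

open Classical in
theorem sum_asg_eq (t : State V E) (I : Instance V E) (e : E) :
    ∑ v ∈ I.ends e, t.asg e v
      = ∑ v ∈ I.ends e ∩ t.D, t.ybar e v + ∑ v ∈ I.ends e \ t.D, t.ys e v := by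
  rw [← Finset.sum_inter_add_sum_sdiff (I.ends e) t.D]
  congr 1
  · exact Finset.sum_congr rfl fun v hv => asg_of_mem (Finset.mem_inter.1 hv).2
  · exact Finset.sum_congr rfl fun v hv => asg_of_notMem (Finset.mem_sdiff.1 hv).2

variable [Fintype V]

open Classical in
theorem sum_val_eq (t : State V E) (f : ℕ) :
    ∑ v, t.val f v = ∑ v ∈ Finset.univ \ t.D, t.xs v + ∑ v ∈ t.D, (t.xbar v : ℝ) / f := by
  rw [← Finset.sum_sdiff (Finset.subset_univ t.D)]
  congr 1
  · exact Finset.sum_congr rfl fun v hv => val_of_notMem (Finset.mem_sdiff.1 hv).2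
  · exact Finset.sum_congr rfl fun v hv => val_of_mem hv

variable [Fintype E] {t : State V E} {I : Instance V E} {f : ℕ} {c : ℝ}

/-- A covering vertex keeps value at least $1/f$. This is why LP2 can use $k_w$ on $W$ where $U_>$
needs $k_u-|T_u|$. -/
theorem Inv.T_eq_empty (h : t.Inv I f c) {w : V} (hw : w ∈ t.W f) : t.T w = ∅ := by
  rw [mem_W] at hw
  refine Finset.eq_empty_of_forall_notMem fun e he => ?_
  have := h.val_tight he
  rw [val_of_notMem hw.1] at this
  linarith [hw.2.2]

open Classical in
theorem Inv.load_xs (h : t.Inv I f c) {v : V} (hv : v ∉ t.D) :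
    ∑ e ∈ Finset.univ.filter (fun e => v ∈ I.ends e ∧ ¬ t.InT e), t.ys e v
      ≤ ((I.k v : ℝ) - ((t.T v).card : ℝ)) * t.xs v := by
  have := h.load v
  simp only [asg_of_notMem hv, val_of_notMem hv] at this
  exact this

/-- The current LP solution is feasible for the next LP2. -/
theorem Inv.restrict_mem_lp2 (h : t.Inv I f c) : t.restrict I ∈ t.lp2 I f := by
  classical
  have hx : ∀ v, v ∉ t.D → (t.restrict I).1 v = t.xs v := fun v hv => if_neg hv
  have hy : ∀ e v, ¬ t.InT e → v ∈ I.ends e → v ∉ t.D → (t.restrict I).2 e v = t.ys e v :=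
    fun e v h1 h2 h3 => if_pos ⟨h1, Finset.mem_sdiff.2 ⟨h2, h3⟩⟩
  have hload : ∀ v, v ∉ t.D →
      ∑ e ∈ Finset.univ.filter (fun e => v ∈ I.ends e ∧ ¬ t.InT e), (t.restrict I).2 e v
      ≤ ((I.k v : ℝ) - ((t.T v).card : ℝ)) * (t.restrict I).1 v := by
    intro v hv
    rw [hx v hv]
    refine (Finset.sum_congr rfl fun e he => ?_).trans_le (h.load_xs hv)
    have := (Finset.mem_filter.1 he).2
    exact hy e v this.2 this.1 hv
  refine ⟨fun e he => ?_, fun e he v hv => ?_, fun u hu => ?_, fun w hw => ?_, fun u hu => ?_,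
    fun w hw => ?_, fun e he v hv => ?_, fun v hv => if_pos hv, fun e v hv => ?_⟩
  · have := h.sum_asg he
    rw [sum_asg_eq] at this
    rw [← this, add_sub_cancel_left]
    refine Finset.sum_congr (by congr) fun v hv => ?_
    rw [Finset.mem_sdiff] at hv
    exact hy e v he hv.1 hv.2
  · rw [Finset.mem_sdiff] at hv
    rw [hy e v he hv.1 hv.2, hx v hv.2]
    have := h.asg_le he hv.1
    rwa [asg_of_notMem hv.2, val_of_notMem hv.2] at this
  · convert hload u (mem_Ugt.1 hu).1
  · have := hload w (mem_W.1 hw).1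
    rw [h.T_eq_empty hw, Finset.card_empty, Nat.cast_zero, sub_zero] at this
    convert this
  · rw [mem_Ugt] at hu
    rw [hx u hu.1]
    have := h.val_le u
    rw [val_of_notMem hu.1] at this
    exact ⟨hu.2.le, this⟩
  · rw [mem_W] at hw
    rw [hx w hw.1]
    exact ⟨hw.2.1.le, hw.2.2.le⟩
  · rw [Finset.mem_sdiff] at hv
    rw [hy e v he hv.1 hv.2]
    have := h.asg_nonneg he hv.1
    rwa [asg_of_notMem hv.2] at this
  · exact if_neg (by convert hv)

/-- Passing to an optimal solution of LP2 preserves the invariant. -/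
theorem Inv.setSol (h : t.Inv I f c) (hf : 0 < f) (hcl : t.Classified f) {p : Point V E}
    (hp : p ∈ t.lp2 I f) (hopt : ∀ q ∈ t.lp2 I f, t.lp2Cost p ≤ t.lp2Cost q) :
    (t.setSol p).Inv I f c := by
  classical
  have hf0 : (0 : ℝ) ≤ 1 / f := by positivity
  have hf1 : 1 / (f : ℝ) ≤ 1 := by
    rw [div_le_one (by positivity)]; exact_mod_cast hf
  have hcost := hopt _ h.restrict_mem_lp2
  obtain ⟨h1, h2, h3, h4, h5, h6, h7, h8, h9⟩ := hp
  have vD : ∀ v, v ∈ t.D → (t.setSol p).val f v = t.val f v := fun v hv => by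
    rw [val_of_mem (s := t.setSol p) hv, val_of_mem hv]; rfl
  have vN : ∀ v, v ∉ t.D → (t.setSol p).val f v = p.1 v := fun v hv =>
    val_of_notMem (s := t.setSol p) hv
  have aD : ∀ e v, v ∈ t.D → (t.setSol p).asg e v = t.asg e v := fun e v hv => by
    rw [asg_of_mem (s := t.setSol p) hv, asg_of_mem hv]; rfl
  have aN : ∀ e v, v ∉ t.D → (t.setSol p).asg e v = p.2 e v := fun e v hv =>
    asg_of_notMem (s := t.setSol p) hv
  refine ⟨h.disj, h.inc, h.ybar_tight, h.ybar_off, fun {e u} he => ?_, h.xbar_le,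
    fun {e} he => ?_, fun {e v} he hv => ?_, fun {e v} he hv => ?_, fun v => ?_, fun v => ?_,
    fun v => ?_, ?_⟩
  · by_cases hu : u ∈ t.D
    · rw [vD u hu]; exact h.val_tight he
    · rw [vN u hu]
      -- Here the lower bound $1/f\le x_u$ of LP2 is used: covering vertices do not fall below
      -- $1/f$.
      rcases hcl u hu with hu' | hu'
      · exact (h5 u hu').1
      · exact absurd he (by simp [State.setSol, h.T_eq_empty hu'])
  · have := h1 e he
    rw [sum_asg_eq, State.setSol]
    dsimp only
    convert (eq_sub_iff_add_eq'.1 this)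
  · by_cases hvD : v ∈ t.D
    · rw [aD e v hvD]; exact h.asg_nonneg he hv
    · rw [aN e v hvD]; exact h7 e he v (Finset.mem_sdiff.2 ⟨hv, hvD⟩)
  · by_cases hvD : v ∈ t.D
    · rw [aD e v hvD, vD v hvD]; exact h.asg_le he hv
    · rw [aN e v hvD, vN v hvD]; exact h2 e he v (Finset.mem_sdiff.2 ⟨hv, hvD⟩)
  · by_cases hvD : v ∈ t.D
    · simp only [aD _ v hvD, vD v hvD]; exact h.load v
    · simp only [aN _ v hvD, vN v hvD]
      rcases hcl v hvD with hv | hv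
      · exact h3 v hv
      · have hT : (t.setSol p).T v = ∅ := h.T_eq_empty hv
        rw [hT, Finset.card_empty, Nat.cast_zero, sub_zero]
        exact h4 v hv
  · by_cases hvD : v ∈ t.D
    · rw [vD v hvD]; exact h.val_nonneg v
    · rw [vN v hvD]
      rcases hcl v hvD with hv | hv
      · exact hf0.trans (h5 v hv).1
      · exact (h6 v hv).1
  · by_cases hvD : v ∈ t.D
    · rw [vD v hvD]; exact h.val_le v
    · rw [vN v hvD]
      rcases hcl v hvD with hv | hv
      · exact (h5 v hv).2
      · refine ((h6 v hv).2.trans hf1).trans ?_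
        have hm := h.val_le v
        rw [val_of_notMem hvD] at hm
        have : (0 : ℝ) < I.m v := (mem_W.1 hv).2.1.trans_le hm
        exact_mod_cast this
  · refine le_trans ?_ h.cost
    -- Determined vertices contribute the same before and after, so only the LP2 objectives are
    -- compared.
    rw [sum_val_eq, sum_val_eq]
    refine add_le_add (le_trans hcost (le_of_eq ?_)) le_rfl
    refine Finset.sum_congr rfl fun v hv => ?_
    exact if_neg (Finset.mem_sdiff.1 hv).2

omit [Fintype E] in
theorem TightStep.D_eq {s t : State V E} (h : s.TightStep I f t) : t.D = s.D := by
  rcases h with ⟨e, u, -, rfl⟩ | ⟨-, rfl⟩ <;> rfl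

omit [Fintype E] in
theorem TightStep.xs_eq {s t : State V E} (h : s.TightStep I f t) : t.xs = s.xs := by
  rcases h with ⟨e, u, -, rfl⟩ | ⟨-, rfl⟩ <;> rfl

/-- The state in which LP2 is solved. -/
theorem Inv.beforeLP {s s₁ : State V E} (h : s.Inv I f c) (hf : 0 < f)
    (hs : (s.fixZ I).TightStep I f s₁) :
    (s₁.fixU I f).Inv I f c ∧ (s₁.fixU I f).Classified f := by
  classical
  refine ⟨((h.fixZ hf).tightStep hs).fixU, fun v hv => ?_⟩
  have hv1 : v ∉ s₁.D ∧ v ∉ s₁.Ueq f := by simpa [State.fixU, not_or] using hv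
  have hv2 : v ∉ s.D ∧ v ∉ s.Z := by simpa [hs.D_eq, State.fixZ, not_or] using hv1.1
  have hxs : (s₁.fixU I f).xs = s.xs := hs.xs_eq
  have h0 := h.val_nonneg v
  rw [val_of_notMem hv2.1] at h0
  have hne0 : s.xs v ≠ 0 := fun h' => hv2.2 (mem_Z.2 ⟨hv2.1, h'⟩)
  have hnef : s.xs v ≠ 1 / (f : ℝ) := fun h' => hv1.2 (mem_Ueq.2 ⟨hv1.1, by rw [hs.xs_eq]; exact h'⟩)
  rw [mem_Ugt, mem_W, hxs]
  rcases lt_or_gt_of_ne hnef with hlt | hgt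
  · exact .inr ⟨hv, lt_of_le_of_ne h0 hne0.symm, hlt⟩
  · exact .inl ⟨hv, hgt⟩

/-- An iteration preserves the invariant, and its LP solution is an extreme point of an LP2. -/
theorem Iter.exists_extremePoint {s s' : State V E} (h : s.Inv I f c) (hf : 0 < f)
    (hs : s.Iter I f s') : ∃ (t : State V E) (p : Point V E),
      p ∈ (t.lp2 I f).extremePoints ℝ ∧ s' = t.setSol p ∧ s'.Inv I f c := by
  obtain ⟨s₁, hs₁, p, hp, rfl⟩ := hs
  obtain ⟨h1, h2⟩ := h.beforeLP hf hs₁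
  exact ⟨_, p, hp.1, rfl, h1.setSol hf h2 hp.1.1 hp.2⟩

theorem Inv.exists_iter {s : State V E} (h : s.Inv I f c) (hf : 0 < f) :
    ∃ s', s.Iter I f s' := by
  obtain ⟨s₁, hs₁⟩ := exists_tightStep (s.fixZ I) I f
  obtain ⟨h1, h2⟩ := h.beforeLP hf hs₁
  obtain ⟨p, hp⟩ := exists_isOptExtreme_lp2 I _ h2 ⟨_, h1.restrict_mem_lp2⟩
  exact ⟨_, s₁, hs₁, p, hp, rfl⟩

open Classical in
/-- The number of determined vertices and tight edges. -/
def progress (s : State V E) : ℕ := s.D.card + (Finset.univ.filter fun e => s.InT e).card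

theorem progress_le (s : State V E) : s.progress ≤ Fintype.card V + Fintype.card E :=
  add_le_add (Finset.card_le_univ _) (Finset.card_le_univ _)

/-- An iteration makes progress if the exit condition does not hold. -/
theorem Iter.progress_le {s s' : State V E} (h : s.Inv I f c) (hs : s.Iter I f s') :
    s.progress ≤ s'.progress ∧ (¬ s.Stop I f → s.progress + 1 ≤ s'.progress) := by
  classical
  obtain ⟨s₁, hs₁, p, -, rfl⟩ := hs
  set s' : State V E := { s₁.fixU I f with xs := p.1, ys := p.2 } with hs'
  have hD : s'.D = (s.D ∪ s.Z) ∪ s₁.Ueq f := by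
    rw [hs']; simp [State.fixU, hs₁.D_eq, State.fixZ]
  have hsub : ∀ e, s.InT e → s₁.InT e := fun e he => by
    rcases hs₁ with ⟨e', u, -, rfl⟩ | ⟨-, rfl⟩
    · exact (cover_InT _ _ _ _ _).2 (.inl he)
    · exact he
  have hDsub : s.D ⊆ s'.D := by
    rw [hD]; exact Finset.subset_union_left.trans Finset.subset_union_left
  have hTsub : (Finset.univ.filter fun e => s.InT e) ⊆ Finset.univ.filter fun e => s'.InT e :=
    Finset.monotone_filter_right _ fun e _ he => hsub e he
  have hle := add_le_add (Finset.card_le_card hDsub) (Finset.card_le_card hTsub)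
  refine ⟨hle, fun h_stop => ?_⟩
  -- If neither set grew, then $Z$ and $U_=$ were empty and there was no tight pair, which is the
  -- exit condition.
  have hcase : (∃ v, v ∈ s'.D ∧ v ∉ s.D) ∨ ∃ e, s'.InT e ∧ ¬ s.InT e := by
    by_contra hcon
    push Not at hcon
    have hZ : s.Z = ∅ := Finset.eq_empty_of_forall_notMem fun v hv =>
      (mem_Z.1 hv).1 (hcon.1 v (by rw [hD]; simp [hv]))
    have hU : s.Ueq f = ∅ := Finset.eq_empty_of_forall_notMem fun v hv => by
      have hv' := mem_Ueq.1 hv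
      refine hv'.1 (hcon.1 v ?_)
      rw [hD, Finset.mem_union, hZ, Finset.union_empty, mem_Ueq, hs₁.D_eq, hs₁.xs_eq]
      exact .inr ⟨by simpa [State.fixZ, hZ] using hv'.1, hv'.2⟩
    refine h_stop ⟨hU, hZ, fun u hu e hue he => ?_⟩
    have hu' := mem_U.1 hu
    have hle := h.asg_le he hue
    rw [asg_of_notMem hu'.1, val_of_notMem hu'.1] at hle
    refine lt_of_le_of_ne hle fun heq => ?_
    have htp : (s.fixZ I).TightPair I f e u :=
      ⟨mem_U.2 ⟨by simpa [State.fixZ, hZ] using hu'.1, hu'.2⟩, hue, he, heq⟩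
    rcases hs₁ with ⟨e', u', h1, rfl⟩ | ⟨h1, -⟩
    · exact h1.2.2.1 (hcon.2 e' ((cover_InT _ I _ _ _).2 (.inr rfl)))
    · exact h1 e u htp
  rcases hcase with ⟨v, hv1, hv2⟩ | ⟨e, he1, he2⟩
  · have h1 := Finset.card_lt_card
      (Finset.ssubset_iff_of_subset hDsub |>.2 ⟨v, hv1, hv2⟩)
    have h2 := Finset.card_le_card hTsub
    unfold State.progress
    omega
  · have h1 := Finset.card_le_card hDsub
    have h2 := Finset.card_lt_card
      (Finset.ssubset_iff_of_subset hTsub |>.2 ⟨e, by simpa using he1, by simpa using he2⟩)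
    unfold State.progress
    omega

end State

/-! ### Invariant and termination for whole executions. -/

section Reach

variable [Fintype V] [Fintype E] {I : Instance V E} {f : ℕ}

theorem Reach.inv {n : ℕ} {s : State V E} (h : Reach I f n s) (hf : 0 < f) {c : ℝ}
    (hc : IsLeast (lp1Cost '' I.lp1) c) : s.Inv I f c := by
  induction h with
  | start p hp =>
    have : lp1Cost p = c := by
      obtain ⟨q, hq, rfl⟩ := hc.1
      exact le_antisymm (hp.2 q hq) (hc.2 ⟨p, hp.1.1, rfl⟩)
    exact this ▸ State.inv_init hp.1.1
  | step n s s' _ _ hs' ih =>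
    obtain ⟨-, -, -, -, h⟩ := State.Iter.exists_extremePoint ih hf hs'
    exact h

/-- The extra $1$ pays for the first iteration, which is performed even if the exit condition
already holds and may then make no progress. -/
theorem Reach.le_progress {n : ℕ} {s : State V E} (h : Reach I f n s) (hf : 0 < f) {c : ℝ}
    (hc : IsLeast (lp1Cost '' I.lp1) c) : n ≤ s.progress + 1 := by
  induction h with
  | start p hp => omega
  | step n s s' hs hn hs' ih =>
    have hp := State.Iter.progress_le (hs.inv hf hc) hs'
    rcases hn with rfl | hn
    · omega
    · have := hp.2 hn
      omega

theorem Reach.le_card {n : ℕ} {s : State V E} (h : Reach I f n s) (hf : 0 < f) {c : ℝ}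
    (hc : IsLeast (lp1Cost '' I.lp1) c) : n ≤ Fintype.card V + Fintype.card E + 1 :=
  (h.le_progress hf hc).trans (Nat.add_le_add_right s.progress_le 1)

/-- Without a terminating execution every execution could be prolonged, beyond the bound on the
number of iterations. -/
theorem exists_terminates (hf : 0 < f) {p : Point V E} (hp : IsOptExtreme I.lp1 lp1Cost p)
    {c : ℝ} (hc : IsLeast (lp1Cost '' I.lp1) c) : ∃ s, Terminates I f s := by
  by_contra hno
  have hall : ∀ n, ∃ s, Reach I f n s := by
    intro n
    induction n with
    | zero => exact ⟨_, .start p hp⟩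
    | succ n ih =>
      obtain ⟨s, hs⟩ := ih
      obtain ⟨s', hs'⟩ := (hs.inv hf hc).exists_iter hf
      refine ⟨s', .step n s s' hs ?_ hs'⟩
      by_contra hcon
      rw [not_or, not_not] at hcon
      exact hno ⟨s, n, Nat.one_le_iff_ne_zero.2 hcon.1, hs, hcon.2⟩
  obtain ⟨s, hs⟩ := hall (Fintype.card V + Fintype.card E + 2)
  have := hs.le_card hf hc
  omega

end Reach

end

/-! ### Feasibility and cost of the rounded output. -/

section

namespace State

variable [Fintype V] [Fintype E] {s : State V E} {I : Instance V E} {f : ℕ} {c : ℝ}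

/-- Rounding up also recovers the determined values, since $\lceil\bar x_v/f\rceil=\bar x_v$ for
$\bar x_v\in\{0,1\}$. The feasibility proof then need not separate the two kinds of vertices. -/
theorem Inv.outX_eq (h : s.Inv I f c) (hf : 0 < f) (v : V) : s.outX v = ⌈s.val f v⌉₊ := by
  by_cases hv : v ∈ s.D
  · rw [val_of_mem hv, outX, if_pos hv]
    have hf1 : (1 : ℝ) ≤ f := by exact_mod_cast hf
    rcases Nat.le_one_iff_eq_zero_or_eq_one.1 (h.xbar_le hv) with hx | hx
    · simp [hx]
    · rw [hx, Nat.cast_one, eq_comm, Nat.ceil_eq_iff one_ne_zero]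
      refine ⟨by simpa using hf, by simpa using inv_le_one_of_one_le₀ hf1⟩
  · rw [val_of_notMem hv, outX, if_neg hv]

theorem Inv.outX_le (h : s.Inv I f c) (hf : 0 < f) (v : V) : s.outX v ≤ I.m v := by
  rw [h.outX_eq hf, Nat.ceil_le]
  exact h.val_le v

omit [Fintype V] [Fintype E] in
theorem outY_eq_asg {e : E} {v : V} (he : ¬ s.InT e) (hv : v ∈ I.ends e) :
    s.outY I e v = s.asg e v := by
  by_cases hD : v ∈ s.D <;> simp [outY, asg, hD, he, hv]

omit [Fintype V] [Fintype E] in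
theorem outY_eq_ybar {e : E} {v : V} (he : s.InT e ∨ v ∉ I.ends e) :
    s.outY I e v = s.ybar e v := by
  rcases he with he | he <;> simp [outY, he]

/-- The output is feasible for LP1. -/
theorem Inv.out_mem_lp1 (h : s.Inv I f c) (hf : 0 < f) :
    ((fun v => (s.outX v : ℝ)), s.outY I) ∈ I.lp1 := by
  classical
  have hf0 : (0 : ℝ) < 1 / f := by positivity
  have hvx : ∀ v, s.val f v ≤ s.outX v := fun v => by
    rw [h.outX_eq hf]; exact Nat.le_ceil _
  have hyT : ∀ {e u v}, e ∈ s.T u → v ∈ I.ends e → s.outY I e v = if v = u then 1 else 0 :=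
    fun he hv => by rw [outY_eq_ybar (.inl ⟨_, he⟩)]; exact h.ybar_tight he hv
  have hxT : ∀ {e u}, e ∈ s.T u → (1 : ℝ) ≤ s.outX u := fun {e u} he => by
    have : (0 : ℝ) < s.outX u := (hf0.trans_le (h.val_tight he)).trans_le (hvx u)
    exact_mod_cast this
  refine ⟨fun e => ?_, fun e v hv => ?_, fun v => ?_, fun v => Nat.cast_le.2 (h.outX_le hf v),
    fun v => Nat.cast_nonneg _, fun e v hv => ?_, fun e v hv => ?_⟩
  · by_cases he : s.InT e
    · obtain ⟨u, hu⟩ := he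
      dsimp only
      rw [Finset.sum_congr rfl fun v hv => hyT hu hv]
      simp [h.inc hu]
    · dsimp only
      rw [Finset.sum_congr rfl fun v hv => outY_eq_asg he hv]
      exact h.sum_asg he
  · dsimp only
    by_cases he : s.InT e
    · obtain ⟨u, hu⟩ := he
      rw [hyT hu hv]
      split_ifs with hvu
      · exact hvu ▸ hxT hu
      · exact Nat.cast_nonneg _
    · rw [outY_eq_asg he hv]
      exact (h.asg_le he hv).trans (hvx v)
  · dsimp only
    have hsplit := Finset.sum_filter_add_sum_filter_not
      (Finset.univ.filter fun e => v ∈ I.ends e) (fun e => s.InT e) (fun e => s.outY I e v)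
    rw [Finset.filter_filter, Finset.filter_filter] at hsplit
    have h1 : ∑ e ∈ Finset.univ.filter (fun e => v ∈ I.ends e ∧ s.InT e), s.outY I e v
        = (s.T v).card := by
      have : ∀ e ∈ Finset.univ.filter (fun e => v ∈ I.ends e ∧ s.InT e),
          s.outY I e v = if e ∈ s.T v then 1 else 0 := by
        intro e he
        obtain ⟨hev, u, hu⟩ := (Finset.mem_filter.1 he).2
        rw [hyT hu hev]
        refine if_congr ⟨fun hvu => hvu ▸ hu, fun hv => h.disj hv hu⟩ rfl rfl
      rw [Finset.sum_congr rfl this, Finset.sum_boole]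
      congr 2
      ext e
      simp only [Finset.mem_filter, Finset.mem_univ, true_and]
      exact ⟨fun he => he.2, fun he => ⟨⟨h.inc he, v, he⟩, he⟩⟩
    have h2 : ∑ e ∈ Finset.univ.filter (fun e => v ∈ I.ends e ∧ ¬ s.InT e), s.outY I e v
        = ∑ e ∈ Finset.univ.filter (fun e => v ∈ I.ends e ∧ ¬ s.InT e), s.asg e v :=
      Finset.sum_congr rfl fun e he => by
        have := (Finset.mem_filter.1 he).2
        exact outY_eq_asg this.2 this.1
    have h3 : 0 ≤ ∑ e ∈ Finset.univ.filter (fun e => v ∈ I.ends e ∧ ¬ s.InT e), s.asg e v :=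
      Finset.sum_nonneg fun e he => by
        have := (Finset.mem_filter.1 he).2
        exact h.asg_nonneg this.2 this.1
    have h4 := h.load v
    rw [h1, h2] at hsplit
    refine hsplit.symm.trans_le ?_
    refine (add_le_add le_rfl h4).trans ?_
    -- Replacing the value by its ceiling needs a nonnegative factor $k_v-|T_v|$. If
    -- $T_v\ne\emptyset$, this follows from a nonnegative load and a positive value, and the $|T_v|$
    -- tight edges are absorbed because the output at $v$ is at least $1$.
    rcases (s.T v).eq_empty_or_nonempty with hT | ⟨e, he⟩
    · rw [hT, Finset.card_empty, Nat.cast_zero, zero_add, sub_zero]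
      exact mul_le_mul_of_nonneg_left (hvx v) (Nat.cast_nonneg _)
    · have hpos : 0 < s.val f v := hf0.trans_le (h.val_tight he)
      have hk : 0 ≤ (I.k v : ℝ) - (s.T v).card :=
        nonneg_of_mul_nonneg_left (h3.trans h4) hpos
      have h5 := mul_le_mul_of_nonneg_left (hvx v) hk
      have h6 := mul_le_mul_of_nonneg_left (hxT he) (Nat.cast_nonneg (α := ℝ) (s.T v).card)
      linarith
  · dsimp only
    by_cases he : s.InT e
    · obtain ⟨u, hu⟩ := he
      rw [hyT hu hv]
      split_ifs <;> norm_num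
    · rw [outY_eq_asg he hv]
      exact h.asg_nonneg he hv
  · dsimp only
    rw [outY_eq_ybar (.inr hv)]
    exact h.ybar_off hv

/-- The cost of the output. -/
theorem Inv.sum_outX_le (h : s.Inv I f c) (hf : 2 ≤ f) (h_stop : s.Stop I f)
    (hW : (s.W f).card ≤ (s.Ufull I f).card) : ∑ v, (s.outX v : ℝ) ≤ f * c := by
  classical
  have hf0 : 0 < f := by omega
  have hf0' : (0 : ℝ) < f := by exact_mod_cast hf0
  have hf2 : (2 : ℝ) ≤ f := by exact_mod_cast hf
  -- Vertexwise accounting: a fully selected vertex has a surplus $(f-1)m_v\ge1$, a vertex of $W$ is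
  -- allowed a deficit of $1$. Elsewhere in $U$, either the output is at most $1\le fx_v$, or
  -- $x_v>1$ and $\lceil x_v\rceil<x_v+1\le 2x_v\le fx_v$.
  have key : ∀ v, (s.outX v : ℝ) + (if v ∈ s.Ufull I f then 1 else 0)
      ≤ f * s.val f v + (if v ∈ s.W f then 1 else 0) := by
    intro v
    by_cases hv : v ∈ s.D
    · have h1 : v ∉ s.Ufull I f := by simp [Ufull, mem_U, hv]
      have h2 : v ∉ s.W f := by simp [mem_W, hv]
      rw [if_neg h1, if_neg h2, val_of_mem hv, outX, if_pos hv, mul_div_cancel₀ _ hf0'.ne']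
    have hval := h.val_nonneg v
    have hout := h.outX_eq hf0 v
    rw [val_of_notMem hv] at *
    have hx0 : s.xs v ≠ 0 := fun h0 => by
      have : v ∈ s.Z := mem_Z.2 ⟨hv, h0⟩
      rw [h_stop.2.1] at this
      exact Finset.notMem_empty _ this
    have hxpos : 0 < s.xs v := lt_of_le_of_ne hval hx0.symm
    rcases lt_or_ge (s.xs v) (1 / f) with hlt | hge
    · have h1 : v ∉ s.Ufull I f := by simp only [Ufull, Finset.mem_filter, mem_U]; grind
      have h2 : v ∈ s.W f := mem_W.2 ⟨hv, hxpos, hlt⟩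
      have hle : s.outX v ≤ 1 := by
        rw [hout, Nat.ceil_le, Nat.cast_one]
        refine hlt.le.trans ?_
        rw [div_le_one hf0']; linarith
      have hle' : (s.outX v : ℝ) ≤ 1 := by exact_mod_cast hle
      rw [if_neg h1, if_pos h2]
      have := mul_pos hf0' hxpos
      linarith
    · have h2 : v ∉ s.W f := fun hw => absurd (mem_W.1 hw).2.2 (not_lt.2 hge)
      rw [if_neg h2]
      by_cases h1 : v ∈ s.Ufull I f
      · rw [if_pos h1]
        have hm : s.xs v = I.m v := (Finset.mem_filter.1 h1).2
        have hom : s.outX v = I.m v := by rw [hout, hm, Nat.ceil_natCast]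
        rw [hom, hm]
        have : (1 : ℝ) ≤ I.m v := by
          rw [hm] at hxpos
          exact_mod_cast hxpos
        nlinarith
      · rw [if_neg h1]
        rcases le_or_gt (s.xs v) 1 with hx1 | hx1
        · have hle : s.outX v ≤ 1 := by
            rw [hout, Nat.ceil_le, Nat.cast_one]; exact hx1
          have hle' : (s.outX v : ℝ) ≤ 1 := by exact_mod_cast hle
          rw [div_le_iff₀ hf0'] at hge
          linarith
        · have := Nat.ceil_lt_add_one hval
          rw [hout]
          nlinarith
  have hsum := Finset.sum_le_sum fun v (_ : v ∈ Finset.univ) => key v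
  rw [Finset.sum_add_distrib, Finset.sum_add_distrib, ← Finset.mul_sum] at hsum
  simp only [Finset.sum_boole, Finset.filter_univ_mem] at hsum
  have hW' : ((s.W f).card : ℝ) ≤ (s.Ufull I f).card := by exact_mod_cast hW
  have := mul_le_mul_of_nonneg_left h.cost hf0'.le
  linarith

end State

end

/-! ### The rank argument at an extreme point of LP2. -/

section

/-- Fewer linear functionals than the dimension have a common nontrivial zero. -/
theorem exists_ne_zero_forall_eq_zero {M κ : Type*} [AddCommGroup M] [Module ℝ M]
    [FiniteDimensional ℝ M] [Fintype κ] (φ : κ → M →ₗ[ℝ] ℝ)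
    (h : Fintype.card κ < Module.finrank ℝ M) : ∃ d ≠ 0, ∀ i, φ i d = 0 := by
  have hker := LinearMap.ker_ne_bot_of_finrank_lt (f := LinearMap.pi φ) (by simpa using h)
  obtain ⟨d, hd, hd0⟩ := Submodule.exists_mem_ne_zero_of_ne_bot hker
  exact ⟨d, hd0, fun i => congrFun (LinearMap.mem_ker.1 hd) i⟩

/-- A point of a set is not extreme if the set contains a small segment around it. -/
theorem notMem_extremePoints {M : Type*} [AddCommGroup M] [Module ℝ M] {P : Set M} {p d : M}
    (hd : d ≠ 0) (h : ∀ᶠ t in nhds (0 : ℝ), p + t • d ∈ P) : p ∉ P.extremePoints ℝ := by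
  intro hp
  obtain ⟨ε, hε, hball⟩ := Metric.eventually_nhds_iff.1 h
  have h1 := @hball (ε / 2) (by simp [abs_of_pos hε, hε])
  have h2 := @hball (-(ε / 2)) (by simp [abs_of_pos hε, hε])
  have := hp.2 h1 h2 ⟨1 / 2, 1 / 2, by norm_num, by norm_num, by norm_num, by module⟩
  rw [add_eq_left, smul_eq_zero] at this
  exact this.elim (fun h => by linarith) hd

/-- A linear inequality survives a small perturbation that preserves it when it is tight. -/
theorem eventually_add_mul_le {a b a' b' : ℝ} (h : a ≤ b) (h' : a = b → a' = b') :
    ∀ᶠ t in nhds (0 : ℝ), a + t * a' ≤ b + t * b' := by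
  rcases h.lt_or_eq with hlt | heq
  · have h1 : Filter.Tendsto (fun t : ℝ => a + t * a') (nhds 0) (nhds (a + 0 * a')) :=
      (by fun_prop : Continuous fun t : ℝ => a + t * a').tendsto 0
    have h2 : Filter.Tendsto (fun t : ℝ => b + t * b') (nhds 0) (nhds (b + 0 * b')) :=
      (by fun_prop : Continuous fun t : ℝ => b + t * b').tendsto 0
    exact (h1.eventually_lt h2 (by simpa using hlt)).mono fun t ht => ht.le
  · exact Filter.Eventually.of_forall fun t => by rw [heq, h' heq]

/-- The coordinate `x v` of a point. -/
def coordX (v : V) : Point V E →ₗ[ℝ] ℝ := LinearMap.proj v ∘ₗ LinearMap.fst ℝ _ _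

/-- The coordinate `y e v` of a point. -/
def coordY (e : E) (v : V) : Point V E →ₗ[ℝ] ℝ :=
  LinearMap.proj v ∘ₗ LinearMap.proj (φ := fun _ : E => V → ℝ) e ∘ₗ LinearMap.snd ℝ _ _

@[simp]
theorem coordX_apply (v : V) (d : Point V E) : coordX v d = d.1 v := rfl

@[simp]
theorem coordY_apply (e : E) (v : V) (d : Point V E) : coordY e v d = d.2 e v := rfl

namespace State

variable [Fintype V] [Fintype E] {t : State V E} {I : Instance V E} {f : ℕ} {c : ℝ}

open Classical in
/-- A direction that respects all the constraints of LP2 that are tight at `p`. -/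
structure IsTightDirection (t : State V E) (I : Instance V E) (f : ℕ) (p d : Point V E) :
    Prop where
  edge : ∀ e, ¬ t.InT e → ∑ v ∈ I.ends e \ t.D, d.2 e v = 0
  le : ∀ e, ¬ t.InT e → ∀ v ∈ I.ends e \ t.D, p.2 e v = p.1 v → d.2 e v = d.1 v
  capU : ∀ u ∈ t.Ugt f, ∑ e ∈ Finset.univ.filter (fun e => u ∈ I.ends e ∧ ¬ t.InT e), p.2 e u
    = ((I.k u : ℝ) - ((t.T u).card : ℝ)) * p.1 u →
      ∑ e ∈ Finset.univ.filter (fun e => u ∈ I.ends e ∧ ¬ t.InT e), d.2 e u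
    = ((I.k u : ℝ) - ((t.T u).card : ℝ)) * d.1 u
  capW : ∀ w ∈ t.W f, ∑ e ∈ Finset.univ.filter (fun e => w ∈ I.ends e ∧ ¬ t.InT e), p.2 e w
    = (I.k w : ℝ) * p.1 w →
      ∑ e ∈ Finset.univ.filter (fun e => w ∈ I.ends e ∧ ¬ t.InT e), d.2 e w
    = (I.k w : ℝ) * d.1 w
  lowU : ∀ u ∈ t.Ugt f, 1 / (f : ℝ) = p.1 u → d.1 u = 0
  highU : ∀ u ∈ t.Ugt f, p.1 u = I.m u → d.1 u = 0
  lowW : ∀ w ∈ t.W f, 0 = p.1 w → d.1 w = 0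
  highW : ∀ w ∈ t.W f, p.1 w = 1 / (f : ℝ) → d.1 w = 0
  nonneg : ∀ e, ¬ t.InT e → ∀ v ∈ I.ends e \ t.D, 0 = p.2 e v → d.2 e v = 0
  off_x : ∀ v ∈ t.D, d.1 v = 0
  off_y : ∀ e v, ¬ (¬ t.InT e ∧ v ∈ I.ends e \ t.D) → d.2 e v = 0

/-- An extreme point of LP2 admits no nontrivial tight direction. -/
theorem IsTightDirection.eq_zero {p d : Point V E} (hd : t.IsTightDirection I f p d)
    (hp : p ∈ (t.lp2 I f).extremePoints ℝ) : d = 0 := by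
  by_contra hne
  refine notMem_extremePoints hne ?_ hp
  obtain ⟨h1, h2, h3, h4, h5, h6, h7, h8, h9⟩ := hp.1
  have e1 : ∀ a : ℝ, ∀ v, (p + a • d).1 v = p.1 v + a * d.1 v := fun a v => rfl
  have e2 : ∀ a : ℝ, ∀ e v, (p + a • d).2 e v = p.2 e v + a * d.2 e v := fun a e v => rfl
  simp only [lp2, Set.mem_ofPred_eq, e1, e2, Finset.sum_add_distrib, ← Finset.mul_sum,
    Filter.eventually_and, Filter.eventually_all]
  have assoc : ∀ a b b' r : ℝ, r * (b + a * b') = r * b + a * (r * b') := fun a b b' r => by ring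
  refine ⟨fun e he => .of_forall fun a => ?_, fun e he v hv => ?_, fun u hu => ?_, fun w hw => ?_,
    fun u hu => ⟨?_, ?_⟩, fun w hw => ⟨?_, ?_⟩, fun e he v hv => ?_,
    fun v hv => .of_forall fun a => ?_, fun e v hv => .of_forall fun a => ?_⟩
  · rw [h1 e he, hd.edge e he, mul_zero, add_zero]
  · exact eventually_add_mul_le (h2 e he v hv) (hd.le e he v hv)
  · simp only [assoc]
    exact eventually_add_mul_le (h3 u hu) (hd.capU u hu)
  · simp only [assoc]
    exact eventually_add_mul_le (h4 w hw) (hd.capW w hw)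
  · simpa using eventually_add_mul_le (a' := 0) (h5 u hu).1 fun h => (hd.lowU u hu h).symm
  · simpa using eventually_add_mul_le (b' := 0) (h5 u hu).2 (hd.highU u hu)
  · simpa using eventually_add_mul_le (a' := 0) (h6 w hw).1 fun h => (hd.lowW w hw h).symm
  · simpa using eventually_add_mul_le (b' := 0) (h6 w hw).2 (hd.highW w hw)
  · simpa using eventually_add_mul_le (a' := 0) (h7 e he v hv) fun h => (hd.nonneg e he v hv h).symm
  · rw [h8 v hv, hd.off_x v hv, mul_zero, add_zero]
  · rw [h9 e v hv, hd.off_y e v hv, mul_zero, add_zero]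

open Classical in
/-- The pairs whose assignment variable is strictly between its bounds. -/
def freePairs (s : State V E) (I : Instance V E) : Finset (E × V) :=
  Finset.univ.filter fun a =>
    ¬ s.InT a.1 ∧ a.2 ∈ I.ends a.1 \ s.D ∧ s.ys a.1 a.2 ≠ 0 ∧ s.ys a.1 a.2 ≠ s.xs a.2

omit [Fintype E] in
/-- When the loop stops, the value of every undetermined vertex is in one of two ranges. -/
theorem Stop.mem_U_or_mem_W {s : State V E} (h_stop : s.Stop I f) {v : V} (hv : v ∉ s.D)
    (h0 : 0 ≤ s.xs v) : v ∈ s.U f ∨ v ∈ s.W f := by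
  rw [mem_U, mem_W]
  rcases lt_or_ge (s.xs v) (1 / f) with hlt | hge
  · refine .inr ⟨hv, lt_of_le_of_ne h0 fun h => ?_, hlt⟩
    exact Finset.notMem_empty v (h_stop.2.1 ▸ mem_Z.2 ⟨hv, h.symm⟩)
  · exact .inl ⟨hv, hge⟩

/-- When the loop stops, every edge with an LP2 variable has a free pair in `U`. -/
theorem Inv.exists_free {s : State V E} (h : s.Inv I f c) (hf : 0 < f) (hI : I.IsHypergraph f)
    (h_stop : s.Stop I f) {e : E} (he : ¬ s.InT e) {v : V} (hv : v ∈ I.ends e) (hvD : v ∉ s.D) :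
    ∃ u ∈ s.U f, (e, u) ∈ s.freePairs I := by
  classical
  by_contra hcon
  push Not at hcon
  have hf0 : (0 : ℝ) < f := by exact_mod_cast hf
  -- On $U$ a pair that is not free has $y=0$, since the exit condition rules out $y=x$; on $W$
  -- already $x_w<1/f$. With at most $f$ endpoints, each receiving at most $1/f$ and `v` strictly
  -- less, the total could not be $1$.
  have hlt : ∀ w ∈ I.ends e, w ∉ s.D → s.asg e w < 1 / f := by
    intro w hw hwD
    have h0 := h.val_nonneg w
    have hle := h.asg_le he hw
    rw [val_of_notMem hwD] at h0 hle
    rcases h_stop.mem_U_or_mem_W hwD h0 with hwU | hwW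
    · rw [asg_of_notMem hwD] at hle ⊢
      have hnot := hcon w hwU
      simp only [freePairs, Finset.mem_filter, Finset.mem_univ, true_and, Finset.mem_sdiff] at hnot
      have hne := (h_stop.2.2 w hwU e hw he).ne
      have : s.ys e w = 0 := by
        by_contra h1
        exact hnot ⟨he, ⟨hw, hwD⟩, h1, hne⟩
      rw [this]; positivity
    · exact hle.trans_lt (mem_W.1 hwW).2.2
  have hle : ∀ w ∈ I.ends e, s.asg e w ≤ 1 / f := by
    intro w hw
    by_cases hwD : w ∈ s.D
    · refine (h.asg_le he hw).trans ?_
      rw [val_of_mem hwD]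
      have : (s.xbar w : ℝ) ≤ 1 := by exact_mod_cast h.xbar_le hwD
      gcongr
    · exact (hlt w hw hwD).le
  have hsum := Finset.sum_lt_sum hle ⟨v, hv, hlt v hv hvD⟩
  rw [h.sum_asg he, Finset.sum_const, nsmul_eq_mul, mul_one_div, one_lt_div hf0] at hsum
  exact absurd (hI e) (not_le.2 (by exact_mod_cast hsum))

/-- When the loop stops, small fractional vertices are at most as many as the fully selected
ones: otherwise there would be more LP2 variables than independent tight constraints. -/
theorem Inv.card_W_le {t s : State V E} {p : Point V E}
    (hp : p ∈ (t.lp2 I f).extremePoints ℝ) (hs : s = t.setSol p) (h : s.Inv I f c) (hf : 0 < f)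
    (hI : I.IsHypergraph f) (h_stop : s.Stop I f) : (s.W f).card ≤ (s.Ufull I f).card := by
  classical
  by_contra! hlt
  have hD : s.D = t.D := by rw [hs]; rfl
  have hInT : ∀ e, s.InT e ↔ t.InT e := fun e => by rw [hs]; rfl
  have hxs : s.xs = p.1 := by rw [hs]; rfl
  have hys : s.ys = p.2 := by rw [hs]; rfl
  obtain ⟨-, -, -, -, h5, h6, -, -, -⟩ := id hp.1
  have hneq : ∀ v, v ∉ s.D → s.xs v ≠ 1 / (f : ℝ) := fun v hv h' =>
    Finset.notMem_empty v (h_stop.1 ▸ mem_Ueq.2 ⟨hv, h'⟩)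
  have hxpos : ∀ v, v ∉ s.D → 0 < s.xs v := fun v hv => by
    have h0 := h.val_nonneg v
    rw [val_of_notMem hv] at h0
    exact lt_of_le_of_ne h0 fun h' => Finset.notMem_empty v (h_stop.2.1 ▸ mem_Z.2 ⟨hv, h'.symm⟩)
  have hU : ∀ v, v ∈ t.Ugt f → v ∈ s.U f := fun v hv =>
    mem_U.2 ⟨hD ▸ (mem_Ugt.1 hv).1, hxs ▸ (h5 v hv).1⟩
  have hW : ∀ v, v ∈ t.W f → v ∈ s.W f := fun v hv => by
    have hvD : v ∉ s.D := hD ▸ (mem_W.1 hv).1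
    refine mem_W.2 ⟨hvD, hxpos v hvD, lt_of_le_of_ne (hxs ▸ (h6 v hv).2) (hneq v hvD)⟩
  set F := s.freePairs I with hF
  set E' := Finset.univ.filter fun e => ¬ s.InT e ∧ (I.ends e \ s.D).Nonempty with hE'
  set W' := (s.W f).filter fun w => ∃ e, (e, w) ∈ F with hW'
  let load (v : V) : Point V E →ₗ[ℝ] ℝ :=
    ∑ e ∈ Finset.univ.filter (fun e => v ∈ I.ends e ∧ ¬ t.InT e), coordY e v
  have hload : ∀ v d, load v d =
      ∑ e ∈ Finset.univ.filter (fun e => v ∈ I.ends e ∧ ¬ t.InT e), d.2 e v := fun v d => by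
    simp [load]
  -- Used only for pairs that are not free: it imposes $d_y=d_x$ when $y=x\ne0$, and $d_y=0$ when
  -- $y=0$ or the coordinate is not a variable of LP2.
  let pairC (a : E × V) : Point V E →ₗ[ℝ] ℝ :=
    if ¬ s.InT a.1 ∧ a.2 ∈ I.ends a.1 \ s.D ∧ s.ys a.1 a.2 ≠ 0
      then coordY a.1 a.2 - coordX a.2 else coordY a.1 a.2
  let φ : (Fᶜ : Finset (E × V)) ⊕ E' ⊕ W' ⊕ s.D ⊕ s.U f ⊕ s.Ufull I f → Point V E →ₗ[ℝ] ℝ :=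
    Sum.elim (fun a => pairC a.1) <|
    Sum.elim (fun e => ∑ v ∈ I.ends e.1 \ t.D, coordY e.1 v) <|
    Sum.elim (fun w => load w.1 - (I.k w.1 : ℝ) • coordX w.1) <|
    Sum.elim (fun v => coordX v.1) <|
    Sum.elim (fun u => load u.1 - ((I.k u.1 : ℝ) - ((t.T u.1).card : ℝ)) • coordX u.1) <|
    (fun u => coordX u.1)
  -- The count is $|E'|+|W'|\le|F|$, from free pairs inside and outside $U$, together with
  -- $|D|+|U|+|W|\le|V|$ and $|U^{=}|<|W|$.
  have hcard : Fintype.card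
      ((Fᶜ : Finset (E × V)) ⊕ E' ⊕ W' ⊕ s.D ⊕ s.U f ⊕ s.Ufull I f)
      < Module.finrank ℝ (Point V E) := by
    have hfin : Module.finrank ℝ (Point V E) = Fintype.card V + Fintype.card (E × V) := by
      simp [Point, Module.finrank_prod, Module.finrank_pi_fintype]
    have hFc := Finset.card_add_card_compl F
    have hEc : E'.card ≤ (F.filter fun a => a.2 ∈ s.U f).card := by
      refine (Finset.card_le_card fun e he => ?_).trans (Finset.card_image_le (f := Prod.fst))
      obtain ⟨heT, v, hv⟩ := (Finset.mem_filter.1 he).2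
      rw [Finset.mem_sdiff] at hv
      obtain ⟨u, hu, hfree⟩ := h.exists_free hf hI h_stop heT hv.1 hv.2
      exact Finset.mem_image.2 ⟨(e, u), Finset.mem_filter.2 ⟨hfree, hu⟩, rfl⟩
    have hWc : W'.card ≤ (F.filter fun a => ¬ a.2 ∈ s.U f).card := by
      refine (Finset.card_le_card fun w hw => ?_).trans (Finset.card_image_le (f := Prod.snd))
      obtain ⟨hw1, e, he⟩ := Finset.mem_filter.1 hw
      refine Finset.mem_image.2 ⟨(e, w), Finset.mem_filter.2 ⟨he, fun hu => ?_⟩, rfl⟩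
      exact absurd (mem_U.1 hu).2 (not_le.2 (mem_W.1 hw1).2.2)
    have hsplit := Finset.card_filter_add_card_filter_not (s := F) (fun a => a.2 ∈ s.U f)
    have hV : s.D.card + (s.U f).card + (s.W f).card ≤ Fintype.card V := by
      rw [← Finset.card_union_of_disjoint, ← Finset.card_union_of_disjoint]
      · exact Finset.card_le_univ _
      · refine Finset.disjoint_left.2 fun v hv hw => ?_
        have hw' := mem_W.1 hw
        rcases Finset.mem_union.1 hv with hv | hv
        · exact hw'.1 hv
        · exact absurd (mem_U.1 hv).2 (not_le.2 hw'.2.2)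
      · exact Finset.disjoint_left.2 fun v hv hu => (mem_U.1 hu).1 hv
    rw [hfin]
    simp only [Fintype.card_sum, Fintype.card_coe]
    omega
  obtain ⟨d, hd0, hd⟩ := exists_ne_zero_forall_eq_zero φ hcard
  have dF : ∀ a, a ∉ F → pairC a d = 0 := fun a ha => hd (.inl ⟨a, Finset.mem_compl.2 ha⟩)
  have dE : ∀ e ∈ E', ∑ v ∈ I.ends e \ t.D, d.2 e v = 0 := fun e he => by
    simpa [φ] using hd (.inr (.inl ⟨e, he⟩))
  have dW : ∀ w ∈ W', load w d = (I.k w : ℝ) * d.1 w := fun w hw => by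
    simpa [φ, sub_eq_zero] using hd (.inr (.inr (.inl ⟨w, hw⟩)))
  have dD : ∀ v ∈ s.D, d.1 v = 0 := fun v hv => by
    simpa [φ] using hd (.inr (.inr (.inr (.inl ⟨v, hv⟩))))
  have dU : ∀ u ∈ s.U f, load u d = ((I.k u : ℝ) - ((t.T u).card : ℝ)) * d.1 u := fun u hu => by
    simpa [φ, sub_eq_zero] using hd (.inr (.inr (.inr (.inr (.inl ⟨u, hu⟩)))))
  have dUf : ∀ u ∈ s.Ufull I f, d.1 u = 0 := fun u hu => by
    simpa [φ] using hd (.inr (.inr (.inr (.inr (.inr ⟨u, hu⟩)))))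
  have mF : ∀ e v, (e, v) ∈ F ↔ ¬ t.InT e ∧ v ∈ I.ends e \ t.D ∧ p.2 e v ≠ 0 ∧ p.2 e v ≠ p.1 v :=
    fun e v => by simp [hF, freePairs, hD, hInT, hxs, hys]
  have dzero : ∀ e v, (¬ t.InT e → v ∈ I.ends e \ t.D → p.2 e v = 0) → d.2 e v = 0 := by
    intro e v hev
    have h1 := dF (e, v) (by rw [mF]; tauto)
    rwa [show pairC (e, v) = coordY e v from if_neg (by rw [hD, hInT, hys]; tauto)] at h1
  have deq : ∀ e v, ¬ t.InT e → v ∈ I.ends e \ t.D → p.2 e v ≠ 0 → p.2 e v = p.1 v →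
      d.2 e v = d.1 v := by
    intro e v h1 h2 h3 h4
    have h5 := dF (e, v) (by rw [mF]; tauto)
    rw [show pairC (e, v) = coordY e v - coordX v from
      if_pos (by rw [hD, hInT, hys]; exact ⟨h1, h2, h3⟩)] at h5
    simpa [sub_eq_zero] using h5
  refine hd0 (IsTightDirection.eq_zero (t := t) (I := I) (f := f) (p := p) ?_ hp)
  refine ⟨fun e he => ?_, fun e he v hv heq => ?_, fun u hu _ => ?_, fun w hw heq => ?_,
    fun u hu heq => ?_, fun u hu heq => ?_, fun w hw heq => ?_, fun w hw heq => ?_,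
    fun e he v hv heq => ?_, fun v hv => dD v (hD ▸ hv), fun e v hv => ?_⟩
  · rcases (I.ends e \ t.D).eq_empty_or_nonempty with h0 | h0
    · rw [h0, Finset.sum_empty]
    · exact dE e (Finset.mem_filter.2 ⟨Finset.mem_univ _, by rwa [hInT], by rwa [hD]⟩)
  · refine deq e v he hv ?_ heq
    rw [heq, ← hxs]
    exact (hxpos v (hD ▸ (Finset.mem_sdiff.1 hv).2)).ne'
  · rw [← hload]; exact dU u (hU u hu)
  · by_cases hw' : w ∈ W'
    · rw [← hload]; exact dW w hw'
    have hwD : w ∉ t.D := (mem_W.1 hw).1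
    have hpos : 0 < p.1 w := hxs ▸ hxpos w (hD ▸ hwD)
    -- With no free pair at `w`, each assignment to `w` is $0$ or $x_w$, so `d` is proportional to
    -- `p` in the coordinates at `w`. The tight capacity equation then passes from `p` to `d`
    -- without a functional of its own.
    have hprop : ∀ e ∈ Finset.univ.filter (fun e => w ∈ I.ends e ∧ ¬ t.InT e),
        d.2 e w * p.1 w = p.2 e w * d.1 w := by
      intro e he
      obtain ⟨hew, heT⟩ := (Finset.mem_filter.1 he).2
      have hsd : w ∈ I.ends e \ t.D := Finset.mem_sdiff.2 ⟨hew, hwD⟩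
      have hnF : (e, w) ∉ F := fun hmem => hw' (Finset.mem_filter.2 ⟨hW w hw, e, hmem⟩)
      by_cases h0 : p.2 e w = 0
      · rw [h0, dzero e w fun _ _ => h0, zero_mul, zero_mul]
      · have heq : p.2 e w = p.1 w := by
          by_contra hne
          exact hnF ((mF e w).2 ⟨heT, hsd, h0, hne⟩)
        rw [deq e w heT hsd h0 heq, heq, mul_comm]
    refine mul_right_cancel₀ hpos.ne' ?_
    rw [Finset.sum_mul, Finset.sum_congr rfl hprop, ← Finset.sum_mul, heq]
    ring
  · exact absurd heq.symm (hxs ▸ hneq u (hD ▸ (mem_Ugt.1 hu).1))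
  · exact dUf u (Finset.mem_filter.2 ⟨hU u hu, by rw [hxs]; exact heq⟩)
  · exact absurd heq (hxs ▸ hxpos w (hD ▸ (mem_W.1 hw).1)).ne
  · exact absurd heq (hxs ▸ hneq w (hD ▸ (mem_W.1 hw).1))
  · exact dzero e v fun _ _ => heq.symm
  · exact dzero e v fun h1 h2 => absurd ⟨h1, h2⟩ hv

end State

theorem Terminates.card_W_le [Fintype V] [Fintype E] {I : Instance V E} {f : ℕ} {s : State V E}
    (h : Terminates I f s) (hf : 0 < f) (hI : I.IsHypergraph f) {c : ℝ}
    (hc : IsLeast (lp1Cost '' I.lp1) c) : (s.W f).card ≤ (s.Ufull I f).card := by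
  obtain ⟨n, hn, hr, h_stop⟩ := h
  cases hr with
  -- At least one iteration was performed, so the final solution is an extreme point of an LP2.
  | start p hp => omega
  | step n s₀ _ hs₀ _ hs' =>
    obtain ⟨t, p, hp, hs, hinv⟩ := State.Iter.exists_extremePoint (hs₀.inv hf hc) hf hs'
    exact State.Inv.card_W_le hp hs hinv hf hI h_stop

end

end VCHC

end

/-! ### The approximation theorem. -/

theorem mainTheorem1 {V E : Type*} [Fintype V] [Fintype E] (I : VCHC.Instance V E) (f : ℕ)
    (hf : 2 ≤ f) (hI : I.IsHypergraph f) (hfeas : I.lp1.Nonempty) :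
    -- the algorithm can start, never gets stuck, and always stops after a bounded number of steps
    (∃ p, VCHC.IsOptExtreme I.lp1 VCHC.lp1Cost p) ∧
    (∀ n s, VCHC.Reach I f n s → (n = 0 ∨ ¬ s.Stop I f) → ∃ s', s.Iter I f s') ∧
    (∀ n s, VCHC.Reach I f n s → n ≤ Fintype.card V + Fintype.card E + 1) ∧
    (∃ s, VCHC.Terminates I f s) ∧
    -- there are few fractional vertices of small value at termination
    (∀ s, VCHC.Terminates I f s → (s.W f).card ≤ (s.Ufull I f).card) ∧
    -- the output is feasible for LP1, and its integral part extends to an integral solution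
    (∀ s, VCHC.Terminates I f s →
      ((fun v => (s.outX v : ℝ)), s.outY I) ∈ I.lp1 ∧ ∃ y, I.IsSolution s.outX y) ∧
    -- its cost is at most `f` times the optimal value of LP1 and of the problem itself
    (∃ opt : ℝ, IsLeast (VCHC.lp1Cost '' I.lp1) opt ∧
      ∀ s, VCHC.Terminates I f s → ∑ v, (s.outX v : ℝ) ≤ (f : ℝ) * opt) ∧
    (∀ s, VCHC.Terminates I f s →
      ∀ x y, I.IsSolution x y → ∑ v, s.outX v ≤ f * ∑ v, x v) := by
  have hf0 : 0 < f := by omega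
  obtain ⟨p, hp⟩ := I.exists_isOptExtreme_lp1 hfeas
  have hc : IsLeast (VCHC.lp1Cost '' I.lp1) (VCHC.lp1Cost p) :=
    ⟨⟨p, hp.1.1, rfl⟩, by rintro _ ⟨q, hq, rfl⟩; exact hp.2 q hq⟩
  have hcost : ∀ s, VCHC.Terminates I f s → ∑ v, (s.outX v : ℝ) ≤ (f : ℝ) * VCHC.lp1Cost p := by
    intro s hs
    have hW := hs.card_W_le hf0 hI hc
    obtain ⟨n, -, hr, h_stop⟩ := hs
    exact (hr.inv hf0 hc).sum_outX_le hf h_stop hW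
  refine ⟨⟨p, hp⟩, fun n s hs _ => (hs.inv hf0 hc).exists_iter hf0, fun n s hs => hs.le_card hf0 hc,
    VCHC.exists_terminates hf0 hp hc, fun s hs => hs.card_W_le hf0 hI hc, fun s hs => ?_,
    ⟨_, hc, hcost⟩, fun s hs x y hxy => ?_⟩
  · obtain ⟨n, -, hr, -⟩ := hs
    have hinv := hr.inv hf0 hc
    have hmem := hinv.out_mem_lp1 hf0
    exact ⟨hmem, I.exists_isSolution_of_mem_lp1 hmem (hinv.outX_le hf0)⟩
  · obtain ⟨y', hy'⟩ := hxy.exists_mem_lp1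
    have h1 := hc.2 ⟨_, hy', rfl⟩
    have h2 := (hcost s hs).trans (mul_le_mul_of_nonneg_left h1 (Nat.cast_nonneg f))
    simp only [VCHC.lp1Cost] at h2
    exact_mod_cast h2
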